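/- Let $L\ge 0$ and $k\ge 1$ be integers, $r=(L+1)^2$ and $N=kr$. Let $\sigma$ be the surface area measure on $\mathbb S^2$, with $\sigma(\mathbb S^2)=4\pi$, let $\mathcal H_{\le L}\subset L^2(\mathbb S^2,\sigma)$ be the complex vector space spanned by all spherical harmonics of degree at most $L$, and let $K_L$ be its reproducing kernel. Let $\{x_1,\dots,x_r\}\subset\mathbb S^2$ be a sample of the Harmonic ensemble, that is, of the determinantal point process of $r$ points with kernel $K_L$: the points are almost surely distinct and the $m$-point intensity functions with respect to $\sigma$ are $\det\bigl(K_L(u_i,u_j)\bigr)_{1\le i,j\le m}$ for $1\le m\le r$. View $\mathbb S^3$ as the unit sphere of $\mathbb C^2$ and let $h:\mathbb S^3\to\mathbb S^2$, $h(z_1,z_2)=\bigl(2\,\mathrm{Re}(\overline{z_1}z_2),\,2\,\mathrm{Im}(\overline{z_1}z_2),\,|z_2|^2-|z_1|^2\bigr)$, be the Hopf fibration, whose fibres are the orbits of $(z_1,z_2)\mapsto(e^{\mathrm i t}z_1,e^{\mathrm i t}z_2)$. Let $s:\mathbb S^2\to\mathbb S^3$ be any measurable map with $h\circ s=\mathrm{id}$,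 and let $\theta_1,\dots,\theta_r$ be independent random phases, uniform on $[0,2\pi]$ and independent of $(x_1,\dots,x_r)$. Let $\omega_N$ consist of the $N$ points $$y_{ij}=e^{\mathrm i(\theta_i+2\pi j/k)}\,s(x_i)\in\mathbb S^3,\qquad 1\le i\le r,\ 0\le j\le k-1,$$ that is, of $k$ randomly rotated roots of unity on the fibre over each $x_i$. Let $E_0(\omega_N)=\sum_{p\ne q}\log\frac1{\|p-q\|}$ be the logarithmic energy, the sum being over ordered pairs of different points of $\omega_N$. Then $E_0(\omega_N)$ is integrable and $$\mathbb E\,[E_0(\omega_N)]=-\frac{N^2}{4}-N\log k+\frac{k^2\sqrt r\,\log r}{4\pi}+k^2\,O(\sqrt r),$$ where the constant implied by $O$ is absolute: there is a constant $C$, independent of $L$, $k$ and $s$, such that for all $L\ge0$ and $k\ge1$ the expectation differs from the sum of the first three terms by at most $C\,k^2\sqrt r$. -/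

import Mathlib

open MeasureTheory ProbabilityTheory
open scoped ENNReal

noncomputable section

namespace HopfHarmonic

/-! ### Spheres, surface measure, logarithmic energy -/

/-- The unit sphere `S²` of `ℝ³`. -/
abbrev S2 : Type := Metric.sphere (0 : EuclideanSpace ℝ (Fin 3)) 1

/-- The unit sphere `S³`, viewed as the unit sphere of `ℂ²` with its Euclidean norm. -/
abbrev S3 : Type := Metric.sphere (0 : EuclideanSpace ℂ (Fin 2)) 1

/-- The surface area measure on `S²`, of total mass `4π`. -/
abbrev surfaceMeasure : Measure S2 :=
  (volume : Measure (EuclideanSpace ℝ (Fin 3))).toSphere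

/-- The logarithmic energy: the sum of `log (1 / ‖y p - y q‖)` over all ordered pairs `p ≠ q`. -/
def logEnergy {ι : Type*} [Fintype ι] [DecidableEq ι] (y : ι → S3) : ℝ :=
  ∑ p : ι, ∑ q : ι, if p ≠ q then
    Real.log (1 / ‖(y p : EuclideanSpace ℂ (Fin 2)) - (y q : EuclideanSpace ℂ (Fin 2))‖) else 0

/-! ### The Hopf fibration -/

/-- The Hopf map in the ambient coordinates: `(z₁, z₂) ↦ [z₁ : z₂]`, followed by the identification
of the complex projective line with `S²` by inverse stereographic projection from `(0, 0, 1)`,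
`[1 : w] ↦ (2 Re w, 2 Im w, |w|² - 1) / (1 + |w|²)`. -/
def hopfCoord (z : EuclideanSpace ℂ (Fin 2)) : EuclideanSpace ℝ (Fin 3) :=
  !₂[2 * (starRingEnd ℂ (z 0) * z 1).re, 2 * (starRingEnd ℂ (z 0) * z 1).im,
    ‖z 1‖ ^ 2 - ‖z 0‖ ^ 2]

theorem hopfCoord_mem (z : S3) :
    hopfCoord z ∈ Metric.sphere (0 : EuclideanSpace ℝ (Fin 3)) 1 := by
  have hz : ‖(z : EuclideanSpace ℂ (Fin 2))‖ = 1 := by simp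
  have h2 := EuclideanSpace.norm_sq_eq (z : EuclideanSpace ℂ (Fin 2))
  rw [hz, Fin.sum_univ_two, ← Complex.normSq_eq_norm_sq, ← Complex.normSq_eq_norm_sq,
    Complex.normSq_apply, Complex.normSq_apply] at h2
  rw [mem_sphere_zero_iff_norm, ← sq_eq_sq₀ (norm_nonneg _) zero_le_one,
    EuclideanSpace.norm_sq_eq, Fin.sum_univ_three]
  simp only [hopfCoord, ← Complex.normSq_eq_norm_sq, Complex.normSq_apply, Real.norm_eq_abs, sq_abs]
  simp
  linear_combination (-((z : EuclideanSpace ℂ (Fin 2)) 0).re ^ 2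
    - ((z : EuclideanSpace ℂ (Fin 2)) 0).im ^ 2 - ((z : EuclideanSpace ℂ (Fin 2)) 1).re ^ 2
    - ((z : EuclideanSpace ℂ (Fin 2)) 1).im ^ 2 - 1) * h2

/-- The Hopf fibration `S³ → S²`. -/
def hopf (z : S3) : S2 := ⟨hopfCoord z, hopfCoord_mem z⟩

/-- The action of `e^{it}` on `S³`, `(z₁, z₂) ↦ (e^{it} z₁, e^{it} z₂)`; its orbits are the fibres
of the Hopf fibration. -/
def rotate (t : ℝ) (z : S3) : S3 :=
  ⟨Complex.exp (t * Complex.I) • (z : EuclideanSpace ℂ (Fin 2)), by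
    rw [mem_sphere_zero_iff_norm, norm_smul, Complex.norm_exp_ofReal_mul_I, one_mul]
    exact mem_sphere_zero_iff_norm.mp z.2⟩

/-- The `r k` points `e^{i (θ_i + 2 π j / k)} s(x_i)`: on the fibre over each of the `r` points
`x_i`, the `k` roots of unity rotated by the phase `θ_i`. Here `s` picks the base point of each
fibre. -/
def hopfLift {r : ℕ} (s : S2 → S3) (k : ℕ) (x : Fin r → S2) (θ : Fin r → ℝ) :
    Fin r × Fin k → S3 :=
  fun p => rotate (θ p.1 + 2 * Real.pi * (p.2 : ℕ) / k) (s (x p.1))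

/-! ### Determinantal point processes -/

section PointProcess

variable {Λ Ω : Type*} [MeasurableSpace Λ] [MeasurableSpace Ω]

/-- A simple process of `N` points: a random variable in `Λ^N` whose components are almost surely
distinct. -/
structure IsSimpleProcess (P : Measure Ω) {N : ℕ} (X : Ω → Fin N → Λ) : Prop where
  measurable : Measurable X
  simple : ∀ᵐ ω ∂P, Function.Injective (X ω)

/-- The number of the points `x_1, …, x_N` that lie in `D`. -/
def numPoints {N : ℕ} (x : Fin N → Λ) (D : Set Λ) : ℝ≥0∞ :=
  ∑ j : Fin N, D.indicator (fun _ => 1) (x j)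

/-- `ρ` is the `k`-point intensity function of the process `X` with respect to `μ`. -/
structure IsIntensityFunction (μ : Measure Λ) (P : Measure Ω) {N k : ℕ} (X : Ω → Fin N → Λ)
    (ρ : (Fin k → Λ) → ℝ) : Prop where
  nonneg : ∀ x, 0 ≤ ρ x
  eq_zero : ∀ x, ¬ Function.Injective x → ρ x = 0
  expectation : ∀ D : Fin k → Set Λ, (∀ i, MeasurableSet (D i)) →
    (∀ i j, i ≠ j → Disjoint (D i) (D j)) →
    ∫⁻ ω, ∏ i, numPoints (X ω) (D i) ∂P =
      ∫⁻ x in Set.univ.pi D, ENNReal.ofReal (ρ x) ∂(Measure.pi fun _ => μ)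

/-- `X` is a determinantal point process of `N` points with kernel `K` with respect to `μ`: a
simple process whose `k`-point intensity function is `det (K (x_i, x_j))` for `1 ≤ k ≤ N`. -/
structure IsDeterminantal (μ : Measure Λ) (K : Λ → Λ → ℂ) (P : Measure Ω) {N : ℕ}
    (X : Ω → Fin N → Λ) : Prop where
  measurable_kernel : Measurable (Function.uncurry K)
  simple : IsSimpleProcess P X
  intensity : ∀ k : ℕ, 1 ≤ k → k ≤ N → ∃ ρ : (Fin k → Λ) → ℝ,
    (∀ x, (ρ x : ℂ) = Matrix.det (Matrix.of fun i j => K (x i) (x j))) ∧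
    IsIntensityFunction μ P X ρ

/-- `K` is the reproducing kernel of the space `H` of functions in `L²(μ)`, that is, the integral
kernel of the orthogonal projection onto `H`. -/
structure IsReproducingKernel (μ : Measure Λ) (H : Submodule ℂ (Λ → ℂ)) (K : Λ → Λ → ℂ) :
    Prop where
  memLp : ∀ f ∈ H, MemLp f 2 μ
  mem : ∀ y, (fun x => K x y) ∈ H
  reproducing : ∀ f ∈ H, ∀ y, f y = ∫ x, starRingEnd ℂ (K x y) * f x ∂μ

end PointProcess

/-! ### The Harmonic ensemble -/

/-- The Laplacian of a polynomial in three variables. -/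
def laplacian (p : MvPolynomial (Fin 3) ℂ) : MvPolynomial (Fin 3) ℂ :=
  ∑ i : Fin 3, MvPolynomial.pderiv i (MvPolynomial.pderiv i p)

/-- A spherical harmonic of degree `l` on `S²`: the restriction of a homogeneous harmonic
polynomial of degree `l`. -/
def IsSphericalHarmonic (l : ℕ) (f : S2 → ℂ) : Prop :=
  ∃ p : MvPolynomial (Fin 3) ℂ, p.IsHomogeneous l ∧ laplacian p = 0 ∧
    ∀ x : S2, f x = MvPolynomial.eval (fun i => (((x : EuclideanSpace ℝ (Fin 3)) i : ℝ) : ℂ)) p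

/-- The space spanned by all spherical harmonics of degree at most `L`. -/
def harmonicSpace (L : ℕ) : Submodule ℂ (S2 → ℂ) :=
  Submodule.span ℂ {f | ∃ l ≤ L, IsSphericalHarmonic l f}

/-- `X` is a sample of the Harmonic ensemble of `r = (L + 1)²` points on `S²`: a determinantal
point process whose kernel is the reproducing kernel of `harmonicSpace L`. -/
def IsHarmonicEnsemble {Ω : Type*} [MeasurableSpace Ω] (L : ℕ) (P : Measure Ω)
    (X : Ω → Fin ((L + 1) ^ 2) → S2) : Prop :=
  ∃ K : S2 → S2 → ℂ, IsReproducingKernel surfaceMeasure (harmonicSpace L) K ∧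
    IsDeterminantal surfaceMeasure K P X

/-- `Θ` is a family of independent random phases, uniform on `[0, 2π]`, independent of `X`. -/
structure IsIndependentUniformPhases {Ω : Type*} [MeasurableSpace Ω] (P : Measure Ω) {r : ℕ}
    (X : Ω → Fin r → S2) (Θ : Ω → Fin r → ℝ) : Prop where
  measurable : Measurable Θ
  uniform : ∀ i, pdf.IsUniform (fun ω => Θ ω i) (Set.Icc 0 (2 * Real.pi)) P volume
  iIndep : iIndepFun (fun i ω => Θ ω i) P
  indep : IndepFun X Θ P

end HopfHarmonic

end

/-! The energy splits over pairs of fibres. On one fibre the `k` points are the vertices of a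
regular `k`-gon on a unit circle, and since the product of `|1 - ζ ^ c|` over the nontrivial `k`-th
roots of unity is `k`, they contribute exactly `-k log k`, whatever the phase; the `r` fibres
together give `-N log k`.

For two points `z`, `w` on different fibres it suffices to average over one phase. With `a = ⟪w, z⟫`
and `q = √(1 - |a|²)`, one has `‖e^{iθ} z - w‖² = (1 + q) |e^{iθ} - b|²`, where `b = conj a / (1 +
q)` lies in the closed unit disc. The circle average of `log |e^{iθ} - b|` vanishes, so the mean of
`log (1 / ‖e^{iθ} z - w‖)` is `-(1/2) log (1 + q)`, and `q` is half the distance of the Hopf images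
(`integral_log_norm_rotate_sub`). The expectation becomes `-N log k - (k²/2) E ∑_{i ≠ j} log (1 +
|x_i - x_j| / 2)`, independently of `s`.

The two-point intensity is `K(x,x)² - K(x,y)²` with `4 π K = S_L(⟪x, y⟫)` and `S_L = ∑_{l ≤ L} (2 l
+ 1) P_l`. By the hat-box theorem the sum has expectation `(r² - I_L) / 2`, where `I_L` is the
integral of `S_L(t)² w(t)` over `[-1, 1]` and `w(t) = log (1 + √((1 - t) / 2))` has integral `1`. So
the expected energy is exactly `-N²/4 - N log k + (k²/4) I_L`, and what remains is `I_L = (2/π) (L +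
1) log (L + 1) + O(L + 1)`.

The increment is handled through `S_{L+1}² - S_L² = (2 L + 3) ((1 + t) P_{L+1}²)'`
(`kernelPoly_succ_sq_sub`). Integration by parts against `w` has no boundary terms and leaves, in
the angle `θ`, the integral of `P_{L+1}(cos θ)²` with a bounded weight. Parity symmetrizes this
weight to one between `(1 - sin θ)/2` and `1/2`, so up to `O(1)` in the increment the weight may be
replaced by `1/2`. Finally the mean square of `P_l(cos θ)` is `π ∑_{a+b=l} c_a² c_b²`, with `c_n`
the coefficients of `(1 - x)^(-1/2)`; Wallis bounds `c_n² ≈ 1/(π n)` turn it into a harmonic sum,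
and the increment at degree `l` is `(2/π) log (l + 1) + O(1)`. -/

noncomputable section

namespace HopfHarmonic

/-! ### Legendre polynomials -/

open Polynomial in
/-- The Legendre polynomials, by Bonnet's recursion. -/
def legendre : ℕ → Polynomial ℝ
  | 0 => 1
  | 1 => X
  | n + 2 => C (1 / ((n : ℝ) + 2)) *
      (C (2 * (n : ℝ) + 3) * (X * legendre (n + 1)) - C ((n : ℝ) + 1) * legendre n)

theorem legendre_zero : legendre 0 = 1 := by rw [legendre]

theorem legendre_one : legendre 1 = Polynomial.X := by rw [legendre]

theorem legendre_add_two (n : ℕ) (t : ℝ) :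
    ((n : ℝ) + 2) * (legendre (n + 2)).eval t =
      (2 * n + 3) * (t * (legendre (n + 1)).eval t) - (n + 1) * (legendre n).eval t := by
  have : (n : ℝ) + 2 ≠ 0 := by positivity
  rw [legendre]
  simp
  field_simp

theorem derivative_legendre_add_two (n : ℕ) (t : ℝ) :
    ((n : ℝ) + 2) * (legendre (n + 2)).derivative.eval t =
      (2 * n + 3) * ((legendre (n + 1)).eval t + t * (legendre (n + 1)).derivative.eval t)
        - (n + 1) * (legendre n).derivative.eval t := by
  have : (n : ℝ) + 2 ≠ 0 := by positivity
  rw [legendre]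
  simp [Polynomial.derivative_mul]
  field_simp

/-- The two relations are proved together because the inductive step for the first needs the second:
it eliminates `P_n'` from the differentiated Bonnet recursion. -/
theorem derivative_legendre_aux (n : ℕ) (t : ℝ) :
    (legendre (n + 1)).derivative.eval t =
        (n + 1) * (legendre n).eval t + t * (legendre n).derivative.eval t ∧
      (legendre n).derivative.eval t =
        t * (legendre (n + 1)).derivative.eval t - (n + 1) * (legendre (n + 1)).eval t := by
  induction n with
  | zero => simp [legendre_zero, legendre_one]
  | succ n ih =>
    obtain ⟨h1, h2⟩ := ih
    have e1 := legendre_add_two n t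
    have e2 := derivative_legendre_add_two n t
    have hn : (n : ℝ) + 2 ≠ 0 := by positivity
    have h3 : (legendre (n + 2)).derivative.eval t =
        (n + 2) * (legendre (n + 1)).eval t + t * (legendre (n + 1)).derivative.eval t := by
      apply mul_left_cancel₀ hn
      linear_combination e2 - ((n : ℝ) + 1) * h2
    push_cast
    rw [show n + 1 + 1 = n + 2 from rfl, show (n : ℝ) + 1 + 1 = n + 2 by ring]
    exact ⟨h3, by linear_combination e1 - t * h3 + h1 + t * h2⟩

theorem derivative_legendre_succ (n : ℕ) (t : ℝ) :
    (legendre (n + 1)).derivative.eval t =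
      (n + 1) * (legendre n).eval t + t * (legendre n).derivative.eval t :=
  (derivative_legendre_aux n t).1

theorem derivative_legendre_eq (n : ℕ) (t : ℝ) :
    (legendre n).derivative.eval t =
      t * (legendre (n + 1)).derivative.eval t - (n + 1) * (legendre (n + 1)).eval t :=
  (derivative_legendre_aux n t).2

theorem legendre_eval_one (n : ℕ) : (legendre n).eval 1 = 1 := by
  induction n using Nat.twoStepInduction with
  | zero => simp [legendre_zero]
  | one => simp [legendre_one]
  | more n h1 h2 =>
    have := legendre_add_two n 1
    rw [h1, h2] at this
    have hn : (n : ℝ) + 2 ≠ 0 := by positivity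
    apply mul_left_cancel₀ hn
    linear_combination this

theorem legendre_eval_neg (n : ℕ) (t : ℝ) :
    (legendre n).eval (-t) = (-1) ^ n * (legendre n).eval t := by
  induction n using Nat.twoStepInduction with
  | zero => simp [legendre_zero]
  | one => simp [legendre_one]
  | more n h1 h2 =>
    have e1 := legendre_add_two n t
    have e2 := legendre_add_two n (-t)
    rw [h1, h2] at e2
    have hn : (n : ℝ) + 2 ≠ 0 := by positivity
    apply mul_left_cancel₀ hn
    rw [e2]
    linear_combination (-(-1) ^ n) * e1

/-- The polynomial `∑_{l ≤ L} (2 l + 1) P_l`, which is `4 π` times the profile of the reproducing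
kernel of the spherical harmonics of degree at most `L`. -/
def kernelPoly (L : ℕ) : Polynomial ℝ :=
  ∑ l ∈ Finset.range (L + 1), Polynomial.C (2 * (l : ℝ) + 1) * legendre l

theorem kernelPoly_eval (L : ℕ) (t : ℝ) : (kernelPoly L).eval t =
    ∑ l ∈ Finset.range (L + 1), (2 * (l : ℝ) + 1) * (legendre l).eval t := by
  simp [kernelPoly, Polynomial.eval_finsetSum]

theorem kernelPoly_zero (t : ℝ) : (kernelPoly 0).eval t = 1 := by
  simp [kernelPoly_eval, legendre_zero]

theorem kernelPoly_succ (L : ℕ) (t : ℝ) : (kernelPoly (L + 1)).eval t =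
    (kernelPoly L).eval t + (2 * (L : ℝ) + 3) * (legendre (L + 1)).eval t := by
  rw [kernelPoly_eval, Finset.sum_range_succ, ← kernelPoly_eval]
  push_cast
  ring

theorem kernelPoly_eval_one (L : ℕ) : (kernelPoly L).eval 1 = ((L : ℝ) + 1) ^ 2 := by
  induction L with
  | zero => simp [kernelPoly_zero]
  | succ L ih =>
    rw [kernelPoly_succ, ih, legendre_eval_one]
    push_cast
    ring

/-- Christoffel–Darboux in telescoped form: `(2 l + 1) P_l = P_{l+1}' - P_{l-1}'`. -/
theorem kernelPoly_eq_derivative (L : ℕ) (t : ℝ) : (kernelPoly L).eval t =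
    (legendre (L + 1)).derivative.eval t + (legendre L).derivative.eval t := by
  induction L with
  | zero => simp [kernelPoly_zero, legendre_zero, legendre_one]
  | succ L ih =>
    rw [kernelPoly_succ, ih, derivative_legendre_succ (L + 1)]
    have := derivative_legendre_eq L t
    push_cast
    linear_combination this

/-- Difference times sum of consecutive kernels. The right-hand side is `(2 L + 3)` times the
derivative of `(1 + t) P_{L+1}(t)²`, which is what makes integration by parts possible. -/
theorem kernelPoly_succ_sq_sub (L : ℕ) (t : ℝ) :
    (kernelPoly (L + 1)).eval t ^ 2 - (kernelPoly L).eval t ^ 2 =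
      (2 * (L : ℝ) + 3) * (legendre (L + 1)).eval t *
        (2 * (1 + t) * (legendre (L + 1)).derivative.eval t + (legendre (L + 1)).eval t) := by
  have h1 := kernelPoly_eq_derivative L t
  have h2 := kernelPoly_eq_derivative (L + 1) t
  have h3 := derivative_legendre_succ (L + 1) t
  have h4 := derivative_legendre_eq L t
  have h5 := kernelPoly_succ L t
  have h6 : (kernelPoly (L + 1)).eval t + (kernelPoly L).eval t =
      2 * (1 + t) * (legendre (L + 1)).derivative.eval t + (legendre (L + 1)).eval t := by
    push_cast at h3
    linear_combination h1 + h2 + h3 + h4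
  rw [← h6]
  linear_combination ((kernelPoly (L + 1)).eval t + (kernelPoly L).eval t) * h5

/-! ### The trigonometric expansion of Legendre polynomials -/

/-- The coefficients `(1/2)_n / n!` of `(1 - x) ^ (-1/2)`. -/
def invSqrtCoeff : ℕ → ℝ
  | 0 => 1
  | n + 1 => (2 * (n : ℝ) + 1) / (2 * n + 2) * invSqrtCoeff n

theorem invSqrtCoeff_succ (n : ℕ) :
    (2 * (n : ℝ) + 2) * invSqrtCoeff (n + 1) = (2 * n + 1) * invSqrtCoeff n := by
  rw [invSqrtCoeff]
  field_simp

-- The differential equation of `(1 - e x)^(-1/2)`, cleared of denominators.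
open PowerSeries in
theorem derivative_mk_invSqrtCoeff (e : ℂ) :
    2 * (1 - C e * X) * derivative ℂ (mk fun n => (invSqrtCoeff n : ℂ) * e ^ n) =
      C e * mk fun n => (invSqrtCoeff n : ℂ) * e ^ n := by
  ext n
  have h2 : (2 : PowerSeries ℂ) = C 2 := (map_ofNat C 2).symm
  have key : ∀ n : ℕ, (2 * (n : ℂ) + 2) * (invSqrtCoeff (n + 1) : ℂ) =
      (2 * n + 1) * (invSqrtCoeff n : ℂ) := fun n => by exact_mod_cast invSqrtCoeff_succ n
  rw [h2, mul_assoc, coeff_C_mul, coeff_C_mul, sub_mul, one_mul, map_sub, mul_assoc, coeff_C_mul]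
  cases n with
  | zero =>
    simp [PowerSeries.coeff_derivative, coeff_mk]
    have := key 0
    simp at this
    linear_combination e * this
  | succ n =>
    rw [coeff_succ_X_mul]
    simp only [PowerSeries.coeff_derivative, coeff_mk]
    have := key (n + 1)
    push_cast at this ⊢
    linear_combination e ^ (n + 2) * this

-- The generating function `(1 - 2 t x + x²)^(-1/2)` factors as `(1 - e x)^(-1/2) (1 - e⁻¹
-- x)^(-1/2)`. The product `F` of the two series satisfies `(1 - 2 t x + x²) F' = (t - x) F`, and
-- comparing coefficients in this equation gives Bonnet's recursion.
open PowerSeries in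
theorem legendre_eval_eq_sum (l : ℕ) (e : ℂ) (he : e ≠ 0) (t : ℝ) (ht : (2 * t : ℂ) = e + e⁻¹) :
    (((legendre l).eval t : ℝ) : ℂ) = ∑ p ∈ Finset.HasAntidiagonal.antidiagonal l,
      (invSqrtCoeff p.1 : ℂ) * e ^ p.1 * ((invSqrtCoeff p.2 : ℂ) * e⁻¹ ^ p.2) := by
  set A : PowerSeries ℂ := mk fun n => (invSqrtCoeff n : ℂ) * e ^ n with hA
  set B : PowerSeries ℂ := mk fun n => (invSqrtCoeff n : ℂ) * e⁻¹ ^ n with hB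
  have hco : ∀ l, coeff l (A * B) = ∑ p ∈ Finset.HasAntidiagonal.antidiagonal l,
      (invSqrtCoeff p.1 : ℂ) * e ^ p.1 * ((invSqrtCoeff p.2 : ℂ) * e⁻¹ ^ p.2) := by
    intro l
    rw [coeff_mul]
    simp [hA, hB, coeff_mk]
  rw [← hco]
  have h1 := derivative_mk_invSqrtCoeff e
  have h2 := derivative_mk_invSqrtCoeff e⁻¹
  rw [← hA] at h1
  rw [← hB] at h2
  have hee : (C e : PowerSeries ℂ) * C e⁻¹ = 1 := by
    rw [← map_mul, mul_inv_cancel₀ he, map_one]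
  have hsum : (C e : PowerSeries ℂ) + C e⁻¹ = 2 * C (t : ℂ) := by
    rw [← map_add, ← ht, map_mul, map_ofNat]
  have hD : derivative ℂ (A * B) = A * derivative ℂ B + B * derivative ℂ A := by
    rw [Derivation.leibniz]; simp
  have hode : derivative ℂ (A * B) - C (2 * t : ℂ) * (X * derivative ℂ (A * B))
      + X * (X * derivative ℂ (A * B)) = C (t : ℂ) * (A * B) - X * (A * B) := by
    have h22 : (2 : PowerSeries ℂ) ≠ 0 := by
      rw [← map_ofNat (C (R := ℂ)) 2]
      exact (map_ne_zero_iff _ (C_injective (R := ℂ))).2 two_ne_zero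
    apply mul_left_cancel₀ h22
    rw [hD]
    have : (C (2 * t : ℂ) : PowerSeries ℂ) = C e + C e⁻¹ := by rw [← map_add, ht]
    rw [this]
    linear_combination (1 - C e⁻¹ * X) * B * h1 + (1 - C e * X) * A * h2 + (A * B) * hsum
      + (- 2 * A * B * X - 2 * X ^ 2 * (A * derivative ℂ B + B * derivative ℂ A)) * hee
  have hrec : ∀ n : ℕ, ((n : ℂ) + 2) * coeff (n + 2) (A * B) =
      (2 * n + 3) * (t * coeff (n + 1) (A * B)) - (n + 1) * coeff n (A * B) := by
    intro n
    have := congrArg (coeff (n + 1)) hode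
    rw [map_add, map_sub, map_sub, coeff_C_mul, coeff_C_mul, coeff_succ_X_mul, coeff_succ_X_mul,
      coeff_succ_X_mul] at this
    cases n with
    | zero =>
      rw [coeff_zero_X_mul] at this
      simp only [PowerSeries.coeff_derivative] at this
      push_cast at this ⊢
      linear_combination this
    | succ n =>
      rw [coeff_succ_X_mul] at this
      simp only [PowerSeries.coeff_derivative] at this
      push_cast at this ⊢
      linear_combination this
  induction l using Nat.twoStepInduction with
  | zero => rw [hco]; simp [legendre_zero, invSqrtCoeff]
  | one =>
    rw [hco]
    simp [legendre_one, invSqrtCoeff, Finset.Nat.antidiagonal_succ]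
    linear_combination (1 / 2 : ℂ) * ht
  | more n i1 i2 =>
    have hn : (n : ℂ) + 2 ≠ 0 := by exact_mod_cast (by positivity : (n : ℝ) + 2 ≠ 0)
    apply mul_left_cancel₀ hn
    rw [hrec, ← i1, ← i2]
    exact_mod_cast congrArg (fun z : ℝ => (z : ℂ)) (legendre_add_two n t)

/-! ### Bounds for the coefficients of `(1 - x) ^ (-1/2)` -/

/-- An exact link to the Wallis product, so that its bounds by `π / 2` transfer to the coefficients.
-/
theorem invSqrtCoeff_sq_mul_wallis (k : ℕ) :
    invSqrtCoeff k ^ 2 * (2 * (k : ℝ) + 1) * Real.Wallis.W k = 1 := by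
  induction k with
  | zero => simp [invSqrtCoeff, Real.Wallis.W]
  | succ k ih =>
    have e : invSqrtCoeff (k + 1) ^ 2 * (2 * ((k + 1 : ℕ) : ℝ) + 1) * Real.Wallis.W (k + 1) =
        invSqrtCoeff k ^ 2 * (2 * (k : ℝ) + 1) * Real.Wallis.W k := by
      rw [Real.Wallis.W_succ, invSqrtCoeff]
      push_cast
      field_simp
      ring
    rw [e, ih]

theorem le_invSqrtCoeff_sq (k : ℕ) : 1 / (Real.pi * (k + 1 / 2)) ≤ invSqrtCoeff k ^ 2 := by
  have h := invSqrtCoeff_sq_mul_wallis k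
  have hw := Real.Wallis.W_le k
  have hπ := Real.pi_pos
  rw [div_le_iff₀ (by positivity)]
  have : invSqrtCoeff k ^ 2 * (2 * (k : ℝ) + 1) * Real.Wallis.W k ≤
      invSqrtCoeff k ^ 2 * (2 * (k : ℝ) + 1) * (Real.pi / 2) := by gcongr
  linarith

theorem invSqrtCoeff_sq_mul_le (k : ℕ) :
    invSqrtCoeff k ^ 2 * (Real.pi * (k + 1 / 2) ^ 2) ≤ k + 1 := by
  have h := invSqrtCoeff_sq_mul_wallis k
  have hw := Real.Wallis.le_W k
  have hπ := Real.pi_pos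
  have : invSqrtCoeff k ^ 2 * (2 * (k : ℝ) + 1) *
      (((2 : ℝ) * k + 1) / (2 * k + 2) * (Real.pi / 2)) ≤ 1 := by
    refine le_trans ?_ h.le
    exact mul_le_mul_of_nonneg_left hw (by positivity)
  calc invSqrtCoeff k ^ 2 * (Real.pi * ((k : ℝ) + 1 / 2) ^ 2)
      = invSqrtCoeff k ^ 2 * (2 * (k : ℝ) + 1) *
        (((2 : ℝ) * k + 1) / (2 * k + 2) * (Real.pi / 2)) * ((k : ℝ) + 1) := by
        field_simp
    _ ≤ 1 * ((k : ℝ) + 1) := by gcongr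
    _ = (k : ℝ) + 1 := one_mul _

/-- The shift `1/4` is the largest that keeps this sequence increasing: in the comparison of
consecutive terms all powers of `k` cancel and `1/4` is left over. -/
theorem monotone_quarter_mul_invSqrtCoeff_sq :
    Monotone fun k : ℕ => ((k : ℝ) + 1 / 4) * invSqrtCoeff k ^ 2 := by
  refine monotone_nat_of_le_succ fun k => ?_
  rw [invSqrtCoeff, mul_pow, ← mul_assoc]
  gcongr
  rw [div_pow, ← mul_div_assoc, le_div_iff₀ (by positivity)]
  push_cast
  nlinarith

/-- An increasing sequence lies below its limit; the cruder bound `invSqrtCoeff_sq_mul_le`, applied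
far out, shows that the limit is at most `1 / π`. -/
theorem invSqrtCoeff_sq_le (k : ℕ) : invSqrtCoeff k ^ 2 ≤ 1 / (Real.pi * (k + 1 / 4)) := by
  have hπ := Real.pi_pos
  have key : (k + 1 / 4) * invSqrtCoeff k ^ 2 ≤ 1 / Real.pi := by
    refine le_of_forall_pos_le_add fun ε hε => ?_
    obtain ⟨m, hm⟩ := exists_nat_gt (1 / (ε * Real.pi))
    have hm' : 1 < (m : ℝ) * (ε * Real.pi) := (div_lt_iff₀ (by positivity)).1 hm
    have h1 := monotone_quarter_mul_invSqrtCoeff_sq (le_max_left k m)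
    have h2 := invSqrtCoeff_sq_mul_le (max k m)
    have h3 : (m : ℝ) ≤ (max k m : ℕ) := by exact_mod_cast le_max_right k m
    set M : ℝ := ((max k m : ℕ) : ℝ)
    have hM : 0 ≤ M := Nat.cast_nonneg _
    refine h1.trans ?_
    set v := invSqrtCoeff (max k m) ^ 2
    have h4 : (M + 1 / 4) * v ≤ (M + 1 / 4) * (M + 1) / (Real.pi * (M + 1 / 2) ^ 2) := by
      rw [le_div_iff₀ (by positivity), mul_assoc]
      gcongr
    refine h4.trans ?_
    have h5 : 1 < M * (ε * Real.pi) := hm'.trans_le (by gcongr)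
    rw [div_add' _ _ _ hπ.ne', div_le_div_iff₀ (by positivity) hπ]
    have h6 : (M + 1 / 4) * (M + 1) ≤ (1 + ε * Real.pi) * (M + 1 / 2) ^ 2 := by
      nlinarith [mul_pos hε hπ, mul_nonneg (mul_pos hε hπ).le hM]
    nlinarith
  rw [le_div_iff₀ (by positivity)]
  rw [le_div_iff₀ hπ] at key
  linarith

/-! ### The mean square of a Legendre polynomial in the angle -/

theorem integral_exp_two_mul_I (m : ℤ) :
    ∫ θ in (0 : ℝ)..Real.pi, Complex.exp (2 * m * Complex.I * θ) = if m = 0 then Real.pi else 0 := by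
  split_ifs with h
  · simp [h]
  · have hc : (2 * m * Complex.I : ℂ) ≠ 0 := by simp [h]
    rw [integral_exp_mul_complex hc]
    have : (2 * m * Complex.I : ℂ) * Real.pi = m * (2 * Real.pi * Complex.I) := by ring
    rw [this, Complex.exp_int_mul_two_pi_mul_I]
    simp

/-- Parseval's identity for the trigonometric expansion of `P_l(cos θ)`. -/
theorem integral_legendre_cos_sq (l : ℕ) :
    ∫ θ in (0 : ℝ)..Real.pi, (legendre l).eval (Real.cos θ) ^ 2 =
      Real.pi * ∑ p ∈ Finset.HasAntidiagonal.antidiagonal l,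
        invSqrtCoeff p.1 ^ 2 * invSqrtCoeff p.2 ^ 2 := by
  have key : ∀ θ : ℝ, (((legendre l).eval (Real.cos θ) ^ 2 : ℝ) : ℂ) =
      ∑ p ∈ Finset.HasAntidiagonal.antidiagonal l, ∑ q ∈ Finset.HasAntidiagonal.antidiagonal l,
        ((invSqrtCoeff p.1 * invSqrtCoeff p.2 * (invSqrtCoeff q.1 * invSqrtCoeff q.2) : ℝ) : ℂ) *
          Complex.exp (2 * ((p.1 : ℤ) - (q.1 : ℤ) : ℤ) * Complex.I * θ) := by
    intro θ
    set e := Complex.exp (Complex.I * θ) with he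
    have he0 : e ≠ 0 := Complex.exp_ne_zero _
    have hinv : e⁻¹ = Complex.exp (-(Complex.I * θ)) := by rw [he, Complex.exp_neg]
    have ht : (2 * (Real.cos θ : ℝ) : ℂ) = e + e⁻¹ := by
      rw [hinv, he, Complex.ofReal_cos, Complex.cos]
      ring_nf
    have h1 := legendre_eval_eq_sum l e he0 (Real.cos θ) ht
    -- The second factor is expanded in `e⁻¹`. As `p.1 + p.2 = q.1 + q.2 = l`, the frequencies are
    -- then `2 (p.1 - q.1)`: even, hence orthogonal already on `[0, π]`.
    have h2 := legendre_eval_eq_sum l e⁻¹ (inv_ne_zero he0) (Real.cos θ)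
      (by rw [inv_inv, ht, add_comm])
    rw [inv_inv] at h2
    rw [Complex.ofReal_pow, sq]
    nth_rewrite 1 [h1]
    rw [h2, Finset.sum_mul_sum]
    refine Finset.sum_congr rfl fun p hp => Finset.sum_congr rfl fun q hq => ?_
    rw [Finset.HasAntidiagonal.mem_antidiagonal] at hp hq
    have hexp : e ^ p.1 * e⁻¹ ^ p.2 * (e⁻¹ ^ q.1 * e ^ q.2) =
        Complex.exp (2 * ((p.1 : ℤ) - (q.1 : ℤ) : ℤ) * Complex.I * θ) := by
      rw [hinv, he, ← Complex.exp_nat_mul, ← Complex.exp_nat_mul, ← Complex.exp_nat_mul,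
        ← Complex.exp_nat_mul, ← Complex.exp_add, ← Complex.exp_add, ← Complex.exp_add]
      congr 1
      have hp' : (p.1 : ℂ) + p.2 = l := by exact_mod_cast hp
      have hq' : (q.1 : ℂ) + q.2 = l := by exact_mod_cast hq
      push_cast
      linear_combination (Complex.I * θ) * (hq' - hp')
    rw [← hexp]
    push_cast
    ring
  have hint : ∀ (a : ℂ) (m : ℤ), IntervalIntegrable
      (fun θ : ℝ => a * Complex.exp (2 * m * Complex.I * θ)) volume 0 Real.pi := fun a m =>
    Continuous.intervalIntegrable (by fun_prop) _ _
  apply Complex.ofReal_injective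
  rw [← intervalIntegral.integral_ofReal]
  simp_rw [key]
  rw [intervalIntegral.integral_finsetSum
    (fun p _ => by
      have := IntervalIntegrable.sum (Finset.HasAntidiagonal.antidiagonal l)
        (f := fun q : ℕ × ℕ => fun θ : ℝ =>
          ((invSqrtCoeff p.1 * invSqrtCoeff p.2 * (invSqrtCoeff q.1 * invSqrtCoeff q.2) : ℝ) : ℂ) *
          Complex.exp (2 * ((p.1 : ℤ) - (q.1 : ℤ) : ℤ) * Complex.I * θ))
        (μ := volume) (a := 0) (b := Real.pi) (fun q _ => hint _ _)
      simpa [Finset.sum_fn] using this)]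
  rw [Complex.ofReal_mul, Complex.ofReal_sum, Finset.mul_sum]
  refine Finset.sum_congr rfl fun p hp => ?_
  rw [intervalIntegral.integral_finsetSum (fun q _ => hint _ _)]
  simp_rw [intervalIntegral.integral_const_mul, integral_exp_two_mul_I]
  rw [Finset.sum_eq_single p]
  · simp
    ring
  · intro q hq hqp
    rw [if_neg]
    · simp
    · intro h
      apply hqp
      rw [Finset.HasAntidiagonal.mem_antidiagonal] at hp hq
      ext <;> omega
  · exact fun h => absurd hp h

/-- Partial fractions: the two denominators add up to `π (l + 2 c)` on the antidiagonal. -/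
theorem sum_inv_mul_inv (l : ℕ) (c : ℝ) (hc : 0 < c) :
    ∑ p ∈ Finset.HasAntidiagonal.antidiagonal l,
      1 / (Real.pi * ((p.1 : ℝ) + c)) * (1 / (Real.pi * ((p.2 : ℝ) + c))) =
    2 / (Real.pi ^ 2 * (l + 2 * c)) * ∑ a ∈ Finset.range (l + 1), 1 / ((a : ℝ) + c) := by
  have hπ := Real.pi_pos
  have h1 : ∀ p ∈ Finset.HasAntidiagonal.antidiagonal l,
      1 / (Real.pi * ((p.1 : ℝ) + c)) * (1 / (Real.pi * ((p.2 : ℝ) + c))) =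
      1 / (Real.pi ^ 2 * (l + 2 * c)) * (1 / ((p.1 : ℝ) + c))
        + 1 / (Real.pi ^ 2 * (l + 2 * c)) * (1 / ((p.2 : ℝ) + c)) := by
    intro p hp
    rw [Finset.HasAntidiagonal.mem_antidiagonal] at hp
    have hp' : (l : ℝ) = p.1 + p.2 := by exact_mod_cast hp.symm
    rw [hp']
    have : (0 : ℝ) < p.1 + p.2 + 2 * c := by positivity
    field_simp
    ring
  rw [Finset.sum_congr rfl h1, Finset.sum_add_distrib, ← Finset.mul_sum, ← Finset.mul_sum,
    Finset.Nat.sum_antidiagonal_eq_sum_range_succ (fun i _ => 1 / ((i : ℝ) + c)),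
    ← Finset.Nat.sum_antidiagonal_swap]
  simp only [Prod.snd_swap]
  rw [Finset.Nat.sum_antidiagonal_eq_sum_range_succ (fun i _ => 1 / ((i : ℝ) + c))]
  ring

theorem harmonic_eq (n : ℕ) : ((harmonic n : ℚ) : ℝ) = ∑ a ∈ Finset.range n, 1 / ((a : ℝ) + 1) := by
  simp [harmonic]

theorem integral_legendre_cos_sq_le (l : ℕ) :
    (2 * (l : ℝ) + 1) / 2 * ∫ θ in (0 : ℝ)..Real.pi, (legendre l).eval (Real.cos θ) ^ 2 ≤
      2 / Real.pi * (5 + Real.log (l + 1)) := by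
  have hπ := Real.pi_pos
  rw [integral_legendre_cos_sq]
  have h1 : ∑ p ∈ Finset.HasAntidiagonal.antidiagonal l, invSqrtCoeff p.1 ^ 2 * invSqrtCoeff p.2 ^ 2
      ≤ 2 / (Real.pi ^ 2 * (l + 2 * (1 / 4))) *
        ∑ a ∈ Finset.range (l + 1), 1 / ((a : ℝ) + 1 / 4) := by
    rw [← sum_inv_mul_inv l (1 / 4) (by norm_num)]
    refine Finset.sum_le_sum fun p _ => ?_
    exact mul_le_mul (invSqrtCoeff_sq_le _) (invSqrtCoeff_sq_le _) (by positivity) (by positivity)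
  have h2 : ∑ a ∈ Finset.range (l + 1), 1 / ((a : ℝ) + 1 / 4) ≤ 5 + Real.log (l + 1) := by
    -- The term `a = 0` equals `4`; the others are dominated by the harmonic sum, which is at most
    -- `1 + log (l + 1)`. Hence the constant `5`.
    rw [Finset.sum_range_succ']
    have h3 : ∑ a ∈ Finset.range l, 1 / (((a + 1 : ℕ) : ℝ) + 1 / 4) ≤ 1 + Real.log (l + 1) := by
      have h4 := harmonic_le_one_add_log (l + 1)
      rw [harmonic_eq, Finset.sum_range_succ] at h4
      push_cast at h4
      have h5 : (0 : ℝ) ≤ 1 / ((l : ℝ) + 1) := by positivity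
      have h6 : ∑ a ∈ Finset.range l, 1 / (((a + 1 : ℕ) : ℝ) + 1 / 4) ≤
          ∑ a ∈ Finset.range l, 1 / ((a : ℝ) + 1) := by
        refine Finset.sum_le_sum fun a _ => ?_
        push_cast
        exact one_div_le_one_div_of_le (by positivity) (by linarith)
      linarith
    norm_num at h3 ⊢
    linarith
  calc (2 * (l : ℝ) + 1) / 2 * (Real.pi * ∑ p ∈ Finset.HasAntidiagonal.antidiagonal l,
        invSqrtCoeff p.1 ^ 2 * invSqrtCoeff p.2 ^ 2)
      ≤ (2 * (l : ℝ) + 1) / 2 * (Real.pi *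
        (2 / (Real.pi ^ 2 * (l + 2 * (1 / 4))) * (5 + Real.log (l + 1)))) := by
        gcongr
        exact h1.trans (by gcongr)
    _ = 2 / Real.pi * (5 + Real.log (l + 1)) := by field_simp; ring

theorem le_integral_legendre_cos_sq (l : ℕ) :
    2 / Real.pi * (Real.log (l + 1) - 1 / 2) ≤
    (2 * (l : ℝ) + 1) / 2 * ∫ θ in (0 : ℝ)..Real.pi, (legendre l).eval (Real.cos θ) ^ 2 := by
  have hπ := Real.pi_pos
  rw [integral_legendre_cos_sq]
  have h1 : 2 / (Real.pi ^ 2 * (l + 2 * (1 / 2))) *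
        ∑ a ∈ Finset.range (l + 1), 1 / ((a : ℝ) + 1 / 2) ≤
      ∑ p ∈ Finset.HasAntidiagonal.antidiagonal l, invSqrtCoeff p.1 ^ 2 * invSqrtCoeff p.2 ^ 2 := by
    rw [← sum_inv_mul_inv l (1 / 2) (by norm_num)]
    refine Finset.sum_le_sum fun p _ => ?_
    exact mul_le_mul (le_invSqrtCoeff_sq _) (le_invSqrtCoeff_sq _) (by positivity) (by positivity)
  have h2 : Real.log (l + 1) ≤ ∑ a ∈ Finset.range (l + 1), 1 / ((a : ℝ) + 1 / 2) := by
    have h4 := log_add_one_le_harmonic l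
    rw [harmonic_eq] at h4
    push_cast at h4
    rw [Finset.sum_range_succ]
    have h6 : ∑ a ∈ Finset.range l, 1 / ((a : ℝ) + 1) ≤
        ∑ a ∈ Finset.range l, 1 / ((a : ℝ) + 1 / 2) := by
      refine Finset.sum_le_sum fun a _ => ?_
      gcongr
      norm_num
    have h5 : (0 : ℝ) ≤ 1 / ((l : ℝ) + 1 / 2) := by positivity
    linarith
  have h3 : Real.log (l + 1) ≤ l + 1 := by
    have := Real.log_le_sub_one_of_pos (by positivity : (0 : ℝ) < l + 1)
    linarith
  -- With shift `1/2` the prefactor is `(2 l + 1) / (2 l + 2) = 1 - 1 / (2 (l + 1))`; the loss is at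
  -- most `1/2` because `log (l + 1) ≤ l + 1`.
  calc 2 / Real.pi * (Real.log (l + 1) - 1 / 2)
      ≤ 2 / Real.pi * (Real.log (l + 1) - 1 / 2 * (Real.log (l + 1) / (l + 1))) := by
        gcongr
        have : Real.log (l + 1) / (l + 1) ≤ 1 := (div_le_one (by positivity)).2 h3
        linarith
    _ = (2 * (l : ℝ) + 1) / 2 * (Real.pi *
        (2 / (Real.pi ^ 2 * (l + 2 * (1 / 2))) * Real.log (l + 1))) := by field_simp; ring
    _ ≤ _ := by
        gcongr
        exact le_trans (by gcongr) h1

/-! ### The weighted mean square of the kernel polynomial -/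

/-- The function `log (1 + |x - y| / 2)` of `t = ⟪x, y⟫`, for unit vectors `x`, `y`. -/
def logWeight (t : ℝ) : ℝ := Real.log (1 + √((1 - t) / 2))

theorem continuous_logWeight : Continuous logWeight :=
  Continuous.log (by fun_prop) fun t => by positivity

theorem logWeight_cos {θ : ℝ} (h0 : 0 ≤ θ) (h1 : θ ≤ Real.pi) :
    logWeight (Real.cos θ) = Real.log (1 + Real.sin (θ / 2)) := by
  rw [logWeight, Real.sin_half_eq_sqrt h0 (by linarith)]

theorem integral_eq_integral_cos {g : ℝ → ℝ} (hg : Continuous g) :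
    ∫ t in (-1 : ℝ)..1, g t = ∫ θ in (0 : ℝ)..Real.pi, g (Real.cos θ) * Real.sin θ := by
  have h := intervalIntegral.integral_comp_mul_deriv (a := 0) (b := Real.pi) (f := Real.cos)
    (f' := fun x => -Real.sin x) (g := g) (fun x _ => Real.hasDerivAt_cos x)
    (Real.continuous_sin.neg.continuousOn) hg
  rw [Real.cos_zero, Real.cos_pi] at h
  rw [intervalIntegral.integral_symm, ← h, ← intervalIntegral.integral_neg]
  simp

/-- The integral `∫ S_L(t)² log (1 + √((1 - t) / 2)) dt` over `[-1, 1]`. -/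
def kernelIntegral (L : ℕ) : ℝ := ∫ t in (-1 : ℝ)..1, (kernelPoly L).eval t ^ 2 * logWeight t

/-- Integration by parts of `((1 + t) p²)' p`-type terms against the weight, done in the angle
because `logWeight` is not differentiable at `t = 1`, whereas `log (1 + sin (θ / 2))` is smooth on
`[0, π]`. The difference of the integrands is an exact derivative whose primitive vanishes at both
ends: at `0` by the logarithm, at `π` by the factor `1 + cos θ`. -/
theorem integral_mul_logWeight (p : Polynomial ℝ) :
    ∫ t in (-1 : ℝ)..1, p.eval t * (2 * (1 + t) * p.derivative.eval t + p.eval t) * logWeight t =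
      ∫ θ in (0 : ℝ)..Real.pi,
        p.eval (Real.cos θ) ^ 2 * (Real.cos (θ / 2) * (1 - Real.sin (θ / 2))) := by
  rw [integral_eq_integral_cos (by have := continuous_logWeight; fun_prop), ← sub_eq_zero,
    ← intervalIntegral.integral_sub]
  rotate_left
  · exact Continuous.intervalIntegrable (by have := continuous_logWeight; fun_prop) _ _
  · exact Continuous.intervalIntegrable (by fun_prop) _ _
  have hd : ∀ θ ∈ Set.uIcc 0 Real.pi, HasDerivAt
      (fun θ => -((1 + Real.cos θ) * p.eval (Real.cos θ) ^ 2 * Real.log (1 + Real.sin (θ / 2))))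
      (p.eval (Real.cos θ) * (2 * (1 + Real.cos θ) * p.derivative.eval (Real.cos θ)
        + p.eval (Real.cos θ)) * logWeight (Real.cos θ) * Real.sin θ
        - p.eval (Real.cos θ) ^ 2 * (Real.cos (θ / 2) * (1 - Real.sin (θ / 2)))) θ := by
    intro θ hθ
    rw [Set.uIcc_of_le Real.pi_pos.le] at hθ
    have hs : 0 ≤ Real.sin (θ / 2) :=
      Real.sin_nonneg_of_nonneg_of_le_pi (by linarith [hθ.1]) (by linarith [hθ.2, Real.pi_pos])
    have hp : HasDerivAt (fun θ => p.eval (Real.cos θ))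
        (p.derivative.eval (Real.cos θ) * -Real.sin θ) θ :=
      (p.hasDerivAt (Real.cos θ)).comp θ (Real.hasDerivAt_cos θ)
    have hsin : HasDerivAt (fun θ => 1 + Real.sin (θ / 2)) (Real.cos (θ / 2) * (1 / 2)) θ := by
      have := (Real.hasDerivAt_sin (θ / 2)).comp θ ((hasDerivAt_id θ).div_const 2)
      simpa using this.const_add 1
    have hlog := hsin.log (by positivity)
    have hmain := (((Real.hasDerivAt_cos θ).const_add 1).mul (hp.pow 2)).mul hlog |>.neg
    refine hmain.congr_deriv ?_
    rw [logWeight_cos hθ.1 hθ.2]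
    have hc : Real.cos θ = 2 * Real.cos (θ / 2) ^ 2 - 1 := by
      rw [← Real.cos_two_mul]; ring_nf
    have h1 := Real.sin_sq_add_cos_sq (θ / 2)
    have h2 : (1 + Real.cos θ) * (Real.cos (θ / 2) * (1 / 2) / (1 + Real.sin (θ / 2))) =
        Real.cos (θ / 2) * (1 - Real.sin (θ / 2)) := by
      rw [hc]
      field_simp
      linear_combination 2 * Real.cos (θ / 2) * h1
    simp only [Pi.mul_apply, Pi.pow_apply]
    push_cast
    linear_combination (-p.eval (Real.cos θ) ^ 2) * h2
  rw [intervalIntegral.integral_eq_sub_of_hasDerivAt hd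
    (Continuous.intervalIntegrable (by have := continuous_logWeight; fun_prop) _ _)]
  simp

theorem kernelIntegral_zero : kernelIntegral 0 = ∫ θ in (0 : ℝ)..Real.pi,
    (legendre 0).eval (Real.cos θ) ^ 2 * (Real.cos (θ / 2) * (1 - Real.sin (θ / 2))) := by
  rw [← integral_mul_logWeight, kernelIntegral]
  simp [kernelPoly_zero, legendre_zero]

theorem kernelIntegral_succ (L : ℕ) : kernelIntegral (L + 1) = kernelIntegral L +
    (2 * (L : ℝ) + 3) * ∫ θ in (0 : ℝ)..Real.pi, (legendre (L + 1)).eval (Real.cos θ) ^ 2 *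
      (Real.cos (θ / 2) * (1 - Real.sin (θ / 2))) := by
  rw [← integral_mul_logWeight, kernelIntegral, kernelIntegral, ← sub_eq_iff_eq_add',
    ← intervalIntegral.integral_const_mul, ← intervalIntegral.integral_sub]
  rotate_left
  · exact Continuous.intervalIntegrable (by have := continuous_logWeight; fun_prop) _ _
  · exact Continuous.intervalIntegrable (by have := continuous_logWeight; fun_prop) _ _
  congr 1 with t
  linear_combination logWeight t * kernelPoly_succ_sq_sub L t

/-- Since `S_0 = 1`, this is also the integral of the weight itself, which produces the leading term
`-N² / 4`. -/
theorem kernelIntegral_zero_eq : kernelIntegral 0 = 1 := by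
  rw [kernelIntegral_zero]
  have hd : ∀ θ ∈ Set.uIcc 0 Real.pi, HasDerivAt
      (fun θ => 2 * Real.sin (θ / 2) - Real.sin (θ / 2) ^ 2)
      ((legendre 0).eval (Real.cos θ) ^ 2 * (Real.cos (θ / 2) * (1 - Real.sin (θ / 2)))) θ := by
    intro θ _
    have hsin : HasDerivAt (fun θ => Real.sin (θ / 2)) (Real.cos (θ / 2) * (1 / 2)) θ := by
      exact (Real.hasDerivAt_sin (θ / 2)).comp θ ((hasDerivAt_id θ).div_const 2)
    refine ((hsin.const_mul 2).sub (hsin.pow 2)).congr_deriv ?_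
    simp [legendre_zero]
    ring
  rw [intervalIntegral.integral_eq_sub_of_hasDerivAt hd
    (Continuous.intervalIntegrable (by fun_prop) _ _)]
  simp
  norm_num

/-- The mean of the boundary weight is half the mean square in the angle, up to the `L²` norm. -/
theorem integral_legendre_weight_mem (l : ℕ) :
    (∫ θ in (0 : ℝ)..Real.pi, (legendre l).eval (Real.cos θ) ^ 2) / 2 -
        (∫ t in (-1 : ℝ)..1, (legendre l).eval t ^ 2) / 2 ≤
      (∫ θ in (0 : ℝ)..Real.pi, (legendre l).eval (Real.cos θ) ^ 2 *
        (Real.cos (θ / 2) * (1 - Real.sin (θ / 2)))) ∧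
    (∫ θ in (0 : ℝ)..Real.pi, (legendre l).eval (Real.cos θ) ^ 2 *
        (Real.cos (θ / 2) * (1 - Real.sin (θ / 2)))) ≤
      (∫ θ in (0 : ℝ)..Real.pi, (legendre l).eval (Real.cos θ) ^ 2) / 2 := by
  set f : ℝ → ℝ := fun θ => (legendre l).eval (Real.cos θ) ^ 2 with hf
  have hfc : Continuous f := by fun_prop
  have hfsymm : ∀ θ, f (Real.pi - θ) = f θ := fun θ => by
    simp only [hf, Real.cos_pi_sub, legendre_eval_neg, mul_pow]
    rw [← pow_mul, mul_comm l, pow_mul]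
    simp
  -- The square of `P_l` is even, so `θ ↦ π - θ` exchanges `sin (θ / 2)` and `cos (θ / 2)` in the
  -- weight; averaging the two forms gives the symmetric weight.
  have hswap : ∫ θ in (0 : ℝ)..Real.pi, f θ * (Real.cos (θ / 2) * (1 - Real.sin (θ / 2))) =
      ∫ θ in (0 : ℝ)..Real.pi, f θ * (Real.sin (θ / 2) * (1 - Real.cos (θ / 2))) := by
    have := intervalIntegral.integral_comp_sub_left (a := 0) (b := Real.pi)
      (fun θ => f θ * (Real.cos (θ / 2) * (1 - Real.sin (θ / 2)))) Real.pi
    rw [sub_self, sub_zero] at this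
    rw [← this]
    congr 1 with θ
    rw [hfsymm, sub_div, Real.cos_pi_div_two_sub, Real.sin_pi_div_two_sub]
  have havg : ∫ θ in (0 : ℝ)..Real.pi, f θ * (Real.cos (θ / 2) * (1 - Real.sin (θ / 2))) =
      ∫ θ in (0 : ℝ)..Real.pi,
        f θ * ((Real.sin (θ / 2) + Real.cos (θ / 2) - Real.sin θ) / 2) := by
    have h2 : (∫ θ in (0 : ℝ)..Real.pi, f θ * (Real.cos (θ / 2) * (1 - Real.sin (θ / 2)))) +
        ∫ θ in (0 : ℝ)..Real.pi, f θ * (Real.sin (θ / 2) * (1 - Real.cos (θ / 2))) =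
        2 * ∫ θ in (0 : ℝ)..Real.pi,
          f θ * ((Real.sin (θ / 2) + Real.cos (θ / 2) - Real.sin θ) / 2) := by
      rw [← intervalIntegral.integral_add
        (Continuous.intervalIntegrable (by fun_prop) _ _)
        (Continuous.intervalIntegrable (by fun_prop) _ _), ← intervalIntegral.integral_const_mul]
      congr 1 with θ
      have : Real.sin θ = 2 * Real.sin (θ / 2) * Real.cos (θ / 2) := by
        rw [← Real.sin_two_mul]; ring_nf
      rw [this]
      ring
    linarith
  rw [havg, integral_eq_integral_cos (by fun_prop)]
  -- With `s`, `c` the half-angle sine and cosine, both in `[0, 1]`: `(s + c)² = 1 + 2 s c ≥ 1`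
  -- gives the lower bound, and `(1 - s) (1 - c) ≥ 0` gives `s + c - 2 s c ≤ 1`.
  have hpt : ∀ θ ∈ Set.Icc 0 Real.pi,
      1 - Real.sin θ ≤ Real.sin (θ / 2) + Real.cos (θ / 2) - Real.sin θ ∧
      Real.sin (θ / 2) + Real.cos (θ / 2) - Real.sin θ ≤ 1 := by
    intro θ hθ
    have hs : 0 ≤ Real.sin (θ / 2) :=
      Real.sin_nonneg_of_nonneg_of_le_pi (by linarith [hθ.1]) (by linarith [hθ.2, Real.pi_pos])
    have hc : 0 ≤ Real.cos (θ / 2) :=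
      Real.cos_nonneg_of_neg_pi_div_two_le_of_le (by linarith [hθ.1, Real.pi_pos])
        (by linarith [hθ.2])
    have h1 := Real.sin_sq_add_cos_sq (θ / 2)
    have h2 : Real.sin θ = 2 * Real.sin (θ / 2) * Real.cos (θ / 2) := by
      rw [← Real.sin_two_mul]; ring_nf
    have h3 := Real.sin_le_one (θ / 2)
    have h4 := Real.cos_le_one (θ / 2)
    rw [h2]
    constructor <;> nlinarith [mul_nonneg hs hc, mul_nonneg (sub_nonneg.2 h3) (sub_nonneg.2 h4)]
  constructor
  · rw [← sub_div, ← intervalIntegral.integral_sub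
      (Continuous.intervalIntegrable (by fun_prop) _ _)
      (Continuous.intervalIntegrable (by fun_prop) _ _), ← intervalIntegral.integral_div]
    refine intervalIntegral.integral_mono_on Real.pi_pos.le
      (Continuous.intervalIntegrable (by fun_prop) _ _)
      (Continuous.intervalIntegrable (by fun_prop) _ _) fun θ hθ => ?_
    have h0 : 0 ≤ f θ := sq_nonneg _
    have h1 := mul_le_mul_of_nonneg_left (hpt θ hθ).1 h0
    simp only [hf] at h1 ⊢
    linarith
  · rw [← intervalIntegral.integral_div]
    refine intervalIntegral.integral_mono_on Real.pi_pos.le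
      (Continuous.intervalIntegrable (by fun_prop) _ _)
      (Continuous.intervalIntegrable (by fun_prop) _ _) fun θ hθ => ?_
    have h0 : 0 ≤ f θ := sq_nonneg _
    have h1 := mul_le_mul_of_nonneg_left (hpt θ hθ).2 h0
    linarith

/-- The errors are at most `10 / π` above and `1 + 1 / π` below, so `7` is generous. The `L²` norm
enters as the hypothesis `hl`; it is computed in `integral_legendre_sq` from the reproducing
property on the sphere. -/
theorem abs_integral_legendre_weight_sub_le (l : ℕ)
    (hl : ∫ t in (-1 : ℝ)..1, (legendre l).eval t ^ 2 = 2 / (2 * l + 1)) :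
    |(2 * (l : ℝ) + 1) * (∫ θ in (0 : ℝ)..Real.pi, (legendre l).eval (Real.cos θ) ^ 2 *
      (Real.cos (θ / 2) * (1 - Real.sin (θ / 2)))) - 2 / Real.pi * Real.log (l + 1)| ≤ 7 := by
  obtain ⟨h1, h2⟩ := integral_legendre_weight_mem l
  have h3 := integral_legendre_cos_sq_le l
  have h4 := le_integral_legendre_cos_sq l
  rw [hl] at h1
  set B := ∫ θ in (0 : ℝ)..Real.pi, (legendre l).eval (Real.cos θ) ^ 2
  set A := ∫ θ in (0 : ℝ)..Real.pi, (legendre l).eval (Real.cos θ) ^ 2 *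
      (Real.cos (θ / 2) * (1 - Real.sin (θ / 2)))
  have hpos : (0 : ℝ) < 2 * l + 1 := by positivity
  have h5 := mul_le_mul_of_nonneg_left h1 hpos.le
  have h6 := mul_le_mul_of_nonneg_left h2 hpos.le
  have h7 : (2 * (l : ℝ) + 1) * (B / 2 - 2 / (2 * l + 1) / 2) = (2 * (l : ℝ) + 1) / 2 * B - 1 := by
    field_simp
  have h8 : 2 / Real.pi ≤ 2 / 3 := by
    gcongr
    exact Real.pi_gt_three.le
  rw [h7] at h5
  rw [abs_le]
  constructor <;> linarith

theorem abs_kernelIntegral_sub_le (hl : ∀ l : ℕ,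
      ∫ t in (-1 : ℝ)..1, (legendre l).eval t ^ 2 = 2 / (2 * l + 1)) (L : ℕ) :
    |kernelIntegral L - 2 / Real.pi * ((L + 1) * Real.log (L + 1))| ≤ 8 * ((L : ℝ) + 1) := by
  have h1 : |kernelIntegral L - 2 / Real.pi * ∑ l ∈ Finset.range (L + 1), Real.log ((l : ℝ) + 1)| ≤
      7 * ((L : ℝ) + 1) := by
    induction L with
    | zero => simp [kernelIntegral_zero_eq]
    | succ L ih =>
      rw [kernelIntegral_succ, Finset.sum_range_succ]
      have h := abs_integral_legendre_weight_sub_le (L + 1) (hl _)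
      push_cast at h ⊢
      rw [show 2 * ((L : ℝ) + 1) + 1 = 2 * L + 3 by ring] at h
      rw [abs_le] at *
      constructor <;> linarith [h.1, h.2, ih.1, ih.2]
  -- A weak form of Stirling: each step changes the difference by `(L + 1) log ((L + 2) / (L + 1))`,
  -- which lies in `[0, 1]`.
  have h2 : |∑ l ∈ Finset.range (L + 1), Real.log ((l : ℝ) + 1) - (L + 1) * Real.log (L + 1)| ≤
      (L : ℝ) + 1 := by
    clear h1
    induction L with
    | zero => simp
    | succ L ih =>
      rw [Finset.sum_range_succ]
      push_cast
      have hp : (0 : ℝ) < L + 1 := by positivity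
      have e1 : Real.log ((L : ℝ) + 1 + 1) - Real.log (L + 1) ≤ 1 / (L + 1) := by
        rw [← Real.log_div (by positivity) (by positivity)]
        refine (Real.log_le_sub_one_of_pos (by positivity)).trans ?_
        apply le_of_eq
        field_simp
        ring
      have e2 : 0 ≤ Real.log ((L : ℝ) + 1 + 1) - Real.log (L + 1) :=
        sub_nonneg.2 (Real.log_le_log hp (by linarith))
      have e3 : ((L : ℝ) + 1) * (Real.log ((L : ℝ) + 1 + 1) - Real.log (L + 1)) ≤ 1 := by
        calc _ ≤ ((L : ℝ) + 1) * (1 / (L + 1)) := by gcongr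
          _ = 1 := by field_simp
      have e4 := mul_nonneg hp.le e2
      rw [abs_le] at *
      constructor <;> nlinarith [ih.1, ih.2]
  have h3 : 2 / Real.pi ≤ 1 := by
    rw [div_le_one Real.pi_pos]
    linarith [Real.pi_gt_three]
  have h4 : |2 / Real.pi * (∑ l ∈ Finset.range (L + 1), Real.log ((l : ℝ) + 1)
      - (L + 1) * Real.log (L + 1))| ≤ (L : ℝ) + 1 := by
    rw [abs_mul, abs_of_pos (by positivity)]
    calc _ ≤ 1 * ((L : ℝ) + 1) := by gcongr
      _ = _ := one_mul _
  rw [abs_le] at *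
  constructor <;> nlinarith [h1.1, h1.2, h4.1, h4.2]

/-! ### Integrals of polynomials over the sphere -/

/-- Evaluation of a complex polynomial at a real vector. -/
def realEval (p : MvPolynomial (Fin 3) ℂ) (x : EuclideanSpace ℝ (Fin 3)) : ℂ :=
  MvPolynomial.eval (fun i => ((x i : ℝ) : ℂ)) p

theorem continuous_realEval (p : MvPolynomial (Fin 3) ℂ) : Continuous (realEval p) := by
  unfold realEval
  simp_rw [MvPolynomial.eval_eq']
  fun_prop

theorem realEval_smul {p : MvPolynomial (Fin 3) ℂ} {d : ℕ} (hp : p.IsHomogeneous d) (r : ℝ)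
    (x : EuclideanSpace ℝ (Fin 3)) : realEval p (r • x) = (r : ℂ) ^ d * realEval p x := by
  unfold realEval
  rw [MvPolynomial.eval_eq', MvPolynomial.eval_eq', Finset.mul_sum]
  refine Finset.sum_congr rfl fun m hm => ?_
  have hd : ∑ i, m i = d := by
    have := hp (MvPolynomial.mem_support_iff.1 hm)
    rw [← this, Finsupp.weight_apply, Finsupp.sum_fintype _ _ (by simp)]
    simp
  simp only [PiLp.smul_apply, smul_eq_mul, Complex.ofReal_mul, mul_pow, Finset.prod_mul_distrib]
  rw [Finset.prod_pow_eq_pow_sum, hd]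
  ring

/-- The integral of a polynomial over the sphere. -/
def sphereIntegral (p : MvPolynomial (Fin 3) ℂ) : ℂ := ∫ x : S2, realEval p x ∂surfaceMeasure

theorem integrable_of_continuous {f : S2 → ℂ} (hf : Continuous f) :
    Integrable f surfaceMeasure := by
  have : CompactSpace S2 := Metric.sphere.compactSpace _ _
  exact hf.integrable_of_hasCompactSupport (HasCompactSupport.of_compactSpace f)

theorem integrable_realEval (p : MvPolynomial (Fin 3) ℂ) :
    Integrable (fun x : S2 => realEval p x) surfaceMeasure :=
  integrable_of_continuous ((continuous_realEval p).comp continuous_subtype_val)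

theorem realEval_add (p q : MvPolynomial (Fin 3) ℂ) (x) :
    realEval (p + q) x = realEval p x + realEval q x := by simp [realEval]

theorem realEval_sub (p q : MvPolynomial (Fin 3) ℂ) (x) :
    realEval (p - q) x = realEval p x - realEval q x := by simp [realEval]

theorem realEval_mul (p q : MvPolynomial (Fin 3) ℂ) (x) :
    realEval (p * q) x = realEval p x * realEval q x := by simp [realEval]

theorem realEval_C (c : ℂ) (x) : realEval (MvPolynomial.C c) x = c := by simp [realEval]

theorem realEval_X (i : Fin 3) (x) : realEval (MvPolynomial.X i) x = ((x i : ℝ) : ℂ) := by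
  simp [realEval]

theorem realEval_sum {ι : Type*} (s : Finset ι) (f : ι → MvPolynomial (Fin 3) ℂ) (x) :
    realEval (∑ i ∈ s, f i) x = ∑ i ∈ s, realEval (f i) x := by simp [realEval]

theorem sphereIntegral_add (p q : MvPolynomial (Fin 3) ℂ) :
    sphereIntegral (p + q) = sphereIntegral p + sphereIntegral q := by
  simp only [sphereIntegral, realEval_add]
  exact integral_add (integrable_realEval p) (integrable_realEval q)

theorem sphereIntegral_sub (p q : MvPolynomial (Fin 3) ℂ) :
    sphereIntegral (p - q) = sphereIntegral p - sphereIntegral q := by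
  simp only [sphereIntegral, realEval_sub]
  exact integral_sub (integrable_realEval p) (integrable_realEval q)

theorem sphereIntegral_C_mul (c : ℂ) (p : MvPolynomial (Fin 3) ℂ) :
    sphereIntegral (MvPolynomial.C c * p) = c * sphereIntegral p := by
  simp only [sphereIntegral, realEval_mul, realEval_C]
  exact integral_const_mul _ _

theorem sphereIntegral_sum {ι : Type*} (s : Finset ι) (f : ι → MvPolynomial (Fin 3) ℂ) :
    sphereIntegral (∑ i ∈ s, f i) = ∑ i ∈ s, sphereIntegral (f i) := by
  simp only [sphereIntegral, realEval_sum]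
  exact integral_finsetSum _ fun i _ => integrable_realEval _

/-- The moment `∫₀^∞ r ^ m exp (-r² / 2) dr`. -/
def radialMoment (m : ℕ) : ℝ := ∫ r in Set.Ioi (0 : ℝ), r ^ m * Real.exp (-(r ^ 2 / 2))

theorem radialMoment_eq (m : ℕ) : radialMoment m =
    (1 / 2 : ℝ) ^ (-((m : ℝ) + 1) / 2) * (1 / 2) * Real.Gamma (((m : ℝ) + 1) / 2) := by
  have h := integral_rpow_mul_exp_neg_mul_rpow (p := 2) (q := m) (b := 1 / 2) two_pos
    (by have : (0 : ℝ) ≤ m := Nat.cast_nonneg m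
        linarith) (by norm_num)
  rw [← h, radialMoment]
  refine setIntegral_congr_fun measurableSet_Ioi fun r _ => ?_
  simp only [Real.rpow_natCast, Real.rpow_two]
  congr 2
  ring

theorem radialMoment_pos (m : ℕ) : 0 < radialMoment m := by
  rw [radialMoment_eq]
  have : 0 < Real.Gamma (((m : ℝ) + 1) / 2) := Real.Gamma_pos_of_pos (by positivity)
  positivity

theorem radialMoment_add_two (m : ℕ) : radialMoment (m + 2) = ((m : ℝ) + 1) * radialMoment m := by
  rw [radialMoment_eq, radialMoment_eq]
  have h1 : (((m + 2 : ℕ) : ℝ) + 1) / 2 = ((m : ℝ) + 1) / 2 + 1 := by push_cast; ring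
  have h2 : -(((m + 2 : ℕ) : ℝ) + 1) / 2 = -((m : ℝ) + 1) / 2 + (-1) := by push_cast; ring
  rw [h1, h2, Real.Gamma_add_one (by positivity), Real.rpow_add (by norm_num), Real.rpow_neg_one]
  ring

/-- Polar coordinates for the Gaussian integral of a homogeneous polynomial. -/
theorem integral_realEval_mul_exp {p : MvPolynomial (Fin 3) ℂ} {d : ℕ} (hp : p.IsHomogeneous d) :
    ∫ x : EuclideanSpace ℝ (Fin 3), realEval p x * (Real.exp (-(‖x‖ ^ 2 / 2)) : ℂ) =
      sphereIntegral p * radialMoment (d + 2) := by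
  let μ : Measure (EuclideanSpace ℝ (Fin 3)) := volume
  let f : EuclideanSpace ℝ (Fin 3) → ℂ := fun x => realEval p x * (Real.exp (-(‖x‖ ^ 2 / 2)) : ℂ)
  have hdim : Module.finrank ℝ (EuclideanSpace ℝ (Fin 3)) = 3 := by simp
  calc ∫ x, f x ∂μ = ∫ x : ({(0)}ᶜ : Set (EuclideanSpace ℝ (Fin 3))), f x.1 ∂(μ.comap (↑)) := by
        rw [integral_subtype_comap (measurableSet_singleton _).compl f,
          restrict_compl_singleton]
    _ = ∫ y : S2 × Set.Ioi (0 : ℝ), realEval p y.1 *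
          ((y.2.1 ^ d * Real.exp (-(y.2.1 ^ 2 / 2)) : ℝ) : ℂ)
          ∂(μ.toSphere.prod (Measure.volumeIoiPow 2)) := by
        have := μ.measurePreserving_homeomorphUnitSphereProd.integral_comp
          (Homeomorph.measurableEmbedding _) (fun y : S2 × Set.Ioi (0 : ℝ) =>
            realEval p y.1 * ((y.2.1 ^ d * Real.exp (-(y.2.1 ^ 2 / 2)) : ℝ) : ℂ))
        rw [hdim] at this
        rw [← this]
        refine integral_congr_ae (Filter.Eventually.of_forall fun x => ?_)
        have hx : ‖x.1‖ ≠ 0 := norm_ne_zero_iff.2 x.2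
        have h1 : x.1 = ‖x.1‖ • (‖x.1‖⁻¹ • x.1) := by rw [smul_smul, mul_inv_cancel₀ hx, one_smul]
        simp only [f, homeomorphUnitSphereProd_apply_snd_coe, homeomorphUnitSphereProd_apply_fst_coe]
        nth_rewrite 1 [h1]
        rw [realEval_smul hp]
        push_cast
        ring
    _ = sphereIntegral p * ∫ r : Set.Ioi (0 : ℝ),
          ((r.1 ^ d * Real.exp (-(r.1 ^ 2 / 2)) : ℝ) : ℂ) ∂(Measure.volumeIoiPow 2) := by
        rw [integral_prod_mul (fun x : S2 => realEval p x)
          (fun r : Set.Ioi (0 : ℝ) => ((r.1 ^ d * Real.exp (-(r.1 ^ 2 / 2)) : ℝ) : ℂ))]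
        rfl
    -- The density `r²` of `volumeIoiPow 2` raises `r ^ d` to `r ^ (d + 2)`.
    _ = sphereIntegral p * radialMoment (d + 2) := by
        congr 1
        rw [integral_complex_ofReal, radialMoment]
        congr 1
        simp only [Measure.volumeIoiPow, ENNReal.ofReal]
        rw [integral_withDensity_eq_integral_smul,
          integral_subtype_comap measurableSet_Ioi fun a : ℝ =>
            Real.toNNReal (a ^ 2) • (a ^ d * Real.exp (-(a ^ 2 / 2)))]
        · refine setIntegral_congr_fun measurableSet_Ioi fun r hr => ?_
          simp only [NNReal.smul_def, Real.coe_toNNReal _ (pow_nonneg hr.out.le 2), smul_eq_mul]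
          ring
        · exact (measurable_subtype_coe.pow_const _).real_toNNReal

theorem integrable_norm_pow_mul_exp (d : ℕ) : Integrable
    (fun x : EuclideanSpace ℝ (Fin 3) => ‖x‖ ^ d * Real.exp (-(‖x‖ ^ 2 / 2))) := by
  have h := integrable_fun_norm_addHaar (E := EuclideanSpace ℝ (Fin 3)) volume
    (f := fun r : ℝ => r ^ d * Real.exp (-(r ^ 2 / 2)))
  rw [h]
  have h2 := integrableOn_rpow_mul_exp_neg_mul_sq (b := 1 / 2) (by norm_num)
    (s := ((d + 2 : ℕ) : ℝ)) (by have : (0 : ℝ) ≤ ((d + 2 : ℕ) : ℝ) := Nat.cast_nonneg _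
                                 linarith)
  refine h2.congr_fun (fun r _ => ?_) measurableSet_Ioi
  simp only [Real.rpow_natCast, finrank_euclideanSpace, Fintype.card_fin, smul_eq_mul]
  rw [show -(1 / 2) * r ^ 2 = -(r ^ 2 / 2) by ring]
  ring

theorem integrable_realEval_mul_exp (p : MvPolynomial (Fin 3) ℂ) : Integrable
    (fun x : EuclideanSpace ℝ (Fin 3) => realEval p x * (Real.exp (-(‖x‖ ^ 2 / 2)) : ℂ)) := by
  unfold realEval
  simp_rw [MvPolynomial.eval_eq', Finset.sum_mul]
  refine integrable_finsetSum _ fun m _ => ?_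
  refine ((integrable_norm_pow_mul_exp (∑ i, m i)).const_mul ‖p.coeff m‖).mono'
    (Continuous.aestronglyMeasurable (by fun_prop)) (Filter.Eventually.of_forall fun x => ?_)
  rw [norm_mul, norm_mul, mul_assoc, norm_prod, ← Finset.prod_pow_eq_pow_sum, Complex.norm_real,
    Real.norm_eq_abs, Real.abs_exp]
  gcongr with i
  rw [norm_pow, Complex.norm_real]
  gcongr
  exact PiLp.norm_apply_le x i

theorem hasLineDerivAt_realEval (p : MvPolynomial (Fin 3) ℂ) (i : Fin 3)
    (x : EuclideanSpace ℝ (Fin 3)) :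
    HasLineDerivAt ℝ (realEval p) (realEval (MvPolynomial.pderiv i p) x) x
      (EuclideanSpace.single i 1) := by
  unfold HasLineDerivAt
  induction p using MvPolynomial.induction_on with
  | C a => simpa [realEval] using hasDerivAt_const (0 : ℝ) a
  | add p q hp hq => simp only [map_add, realEval_add]; exact hp.add hq
  | mul_X p j hp =>
    have hX : HasDerivAt (fun t : ℝ => realEval (MvPolynomial.X j) (x + t • EuclideanSpace.single i 1))
        (realEval (MvPolynomial.pderiv i (MvPolynomial.X j)) x) 0 := by
      simp only [realEval_X, MvPolynomial.pderiv_X]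
      have h1 : HasDerivAt (fun t : ℝ => x j + t * (Pi.single (M := fun _ => ℝ) i 1 : Fin 3 → ℝ) j)
          ((Pi.single (M := fun _ => ℝ) i 1 : Fin 3 → ℝ) j) 0 := by
        simpa using ((hasDerivAt_id (0 : ℝ)).mul_const
          ((Pi.single (M := fun _ => ℝ) i 1 : Fin 3 → ℝ) j)).const_add (x j)
      have h2 := h1.ofReal_comp
      refine (h2.congr_deriv ?_).congr_of_eventuallyEq (Filter.Eventually.of_forall fun t => ?_)
      · by_cases hij : i = j
        · subst hij; simp [realEval]
        · simp [realEval, Ne.symm hij]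
      · by_cases hij : i = j
        · subst hij; simp
        · simp [Ne.symm hij]
    have := hp.mul hX
    simp only [zero_smul, add_zero] at this
    simp only [realEval_mul, Derivation.leibniz, realEval_add, smul_eq_mul]
    refine this.congr_deriv ?_
    ring

theorem hasLineDerivAt_exp (i : Fin 3) (x : EuclideanSpace ℝ (Fin 3)) :
    HasLineDerivAt ℝ (fun x : EuclideanSpace ℝ (Fin 3) => (Real.exp (-(‖x‖ ^ 2 / 2)) : ℂ))
      (-(x i : ℂ) * (Real.exp (-(‖x‖ ^ 2 / 2)) : ℂ)) x (EuclideanSpace.single i 1) := by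
  unfold HasLineDerivAt
  have h1 : HasDerivAt (fun t : ℝ => ‖x + t • EuclideanSpace.single i (1 : ℝ)‖ ^ 2)
      (2 * inner ℝ x (EuclideanSpace.single i (1 : ℝ))) 0 := by
    have h0 : HasDerivAt (fun t : ℝ => x + t • EuclideanSpace.single i (1 : ℝ))
        (EuclideanSpace.single i (1 : ℝ)) 0 := by
      simpa using ((hasDerivAt_id (0 : ℝ)).smul_const (EuclideanSpace.single i (1 : ℝ))).const_add x
    simpa using h0.norm_sq
  have h2 := ((h1.div_const 2).neg.exp).ofReal_comp
  refine h2.congr_deriv ?_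
  simp [EuclideanSpace.inner_single_right]
  ring

/-- Gaussian integration by parts. -/
theorem integral_X_mul_exp (p : MvPolynomial (Fin 3) ℂ) (i : Fin 3) :
    ∫ x : EuclideanSpace ℝ (Fin 3),
        realEval (MvPolynomial.X i * p) x * (Real.exp (-(‖x‖ ^ 2 / 2)) : ℂ) =
      ∫ x : EuclideanSpace ℝ (Fin 3),
        realEval (MvPolynomial.pderiv i p) x * (Real.exp (-(‖x‖ ^ 2 / 2)) : ℂ) := by
  have h := integral_bilinear_hasLineDerivAt_right_eq_neg_left_of_integrable
    (μ := (volume : Measure (EuclideanSpace ℝ (Fin 3)))) (B := ContinuousLinearMap.mul ℝ ℂ)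
    (f := realEval p) (f' := realEval (MvPolynomial.pderiv i p))
    (g := fun x : EuclideanSpace ℝ (Fin 3) => (Real.exp (-(‖x‖ ^ 2 / 2)) : ℂ))
    (g' := fun x => -(x i : ℂ) * (Real.exp (-(‖x‖ ^ 2 / 2)) : ℂ))
    (v := EuclideanSpace.single i 1)
    (by simpa using integrable_realEval_mul_exp _)
    (by
      refine (integrable_realEval_mul_exp (MvPolynomial.X i * p)).neg.congr
        (Filter.Eventually.of_forall fun x => ?_)
      simp only [realEval_mul, realEval_X, ContinuousLinearMap.mul_apply', Pi.neg_apply]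
      ring)
    (by simpa using integrable_realEval_mul_exp _)
    (fun x _ => hasLineDerivAt_realEval p i x) (fun x _ => hasLineDerivAt_exp i x)
  simp only [ContinuousLinearMap.mul_apply'] at h
  rw [← neg_inj, ← h, ← integral_neg]
  refine integral_congr_ae (Filter.Eventually.of_forall fun x => ?_)
  simp only [realEval_mul, realEval_X]
  ring

/-- The divergence theorem on the ball, for a homogeneous polynomial. -/
theorem sphereIntegral_X_mul {p : MvPolynomial (Fin 3) ℂ} {d : ℕ} (hp : p.IsHomogeneous d)
    (i : Fin 3) : ((d : ℂ) + 2) * sphereIntegral (MvPolynomial.X i * p) =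
      sphereIntegral (MvPolynomial.pderiv i p) := by
  have h1 := integral_realEval_mul_exp ((MvPolynomial.isHomogeneous_X ℂ i).mul hp)
  rw [integral_X_mul_exp] at h1
  cases d with
  | zero =>
    -- In degree `0` there is no degree `d - 1` for the derivative; `p` is constant and both sides
    -- vanish.
    have h0 : MvPolynomial.pderiv i p = 0 := by
      rw [← MvPolynomial.totalDegree_zero_iff_isHomogeneous,
        MvPolynomial.totalDegree_eq_zero_iff_eq_C] at hp
      rw [hp]
      simp
    have hm : ((radialMoment (1 + 0 + 2) : ℝ) : ℂ) ≠ 0 :=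
      Complex.ofReal_ne_zero.2 (radialMoment_pos _).ne'
    rw [h0] at h1 ⊢
    simp only [realEval, map_zero, zero_mul, integral_zero] at h1
    have := (mul_eq_zero.1 h1.symm).resolve_right hm
    rw [this]
    simp [sphereIntegral, realEval]
  | succ d =>
    have hd : (MvPolynomial.pderiv i p).IsHomogeneous d := by simpa using hp.pderiv (i := i)
    have h2 := integral_realEval_mul_exp hd
    rw [h2, show 1 + (d + 1) + 2 = (d + 2) + 2 by ring, radialMoment_add_two (d + 2)] at h1
    have hm : ((radialMoment (d + 2) : ℝ) : ℂ) ≠ 0 :=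
      Complex.ofReal_ne_zero.2 (radialMoment_pos _).ne'
    apply mul_right_cancel₀ hm
    rw [h1]
    push_cast
    ring

open MvPolynomial (pderiv C X)

/-! ### Harmonic polynomials -/

theorem pderiv_comm (i j : Fin 3) (p : MvPolynomial (Fin 3) ℂ) :
    pderiv i (pderiv j p) = pderiv j (pderiv i p) := by
  have h : ⁅(pderiv i : Derivation ℂ (MvPolynomial (Fin 3) ℂ) (MvPolynomial (Fin 3) ℂ)),
      (pderiv j : Derivation ℂ (MvPolynomial (Fin 3) ℂ) (MvPolynomial (Fin 3) ℂ))⁆ = 0 := by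
    refine MvPolynomial.derivation_ext fun k => ?_
    rw [Derivation.commutator_apply]
    simp only [MvPolynomial.pderiv_X, Derivation.zero_apply]
    by_cases hi : i = k <;> by_cases hj : j = k <;> simp [hi, hj, eq_comm]
  have h2 := congrArg (fun D => D p) h
  simp only [Derivation.commutator_apply, Derivation.zero_apply] at h2
  exact sub_eq_zero.1 h2

/-- The derivative in the direction of `y`. -/
def dirDeriv (y : EuclideanSpace ℝ (Fin 3)) :
    Derivation ℂ (MvPolynomial (Fin 3) ℂ) (MvPolynomial (Fin 3) ℂ) :=
  let D (i : Fin 3) : Derivation ℂ (MvPolynomial (Fin 3) ℂ) (MvPolynomial (Fin 3) ℂ) := pderiv i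
  let c (i : Fin 3) : MvPolynomial (Fin 3) ℂ := C (y i : ℂ)
  c 0 • D 0 + c 1 • D 1 + c 2 • D 2

theorem dirDeriv_apply (y : EuclideanSpace ℝ (Fin 3)) (p : MvPolynomial (Fin 3) ℂ) :
    dirDeriv y p = C (y 0 : ℂ) * pderiv 0 p + C (y 1 : ℂ) * pderiv 1 p
      + C (y 2 : ℂ) * pderiv 2 p := rfl

/-- The linear form `x ↦ ⟪x, y⟫`. -/
def linForm (y : EuclideanSpace ℝ (Fin 3)) : MvPolynomial (Fin 3) ℂ :=
  C (y 0 : ℂ) * X 0 + C (y 1 : ℂ) * X 1 + C (y 2 : ℂ) * X 2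

/-- The quadratic form `x ↦ |x|²`. -/
def normSqForm : MvPolynomial (Fin 3) ℂ := X 0 ^ 2 + X 1 ^ 2 + X 2 ^ 2

theorem laplacian_apply (p : MvPolynomial (Fin 3) ℂ) :
    laplacian p = pderiv 0 (pderiv 0 p) + pderiv 1 (pderiv 1 p) + pderiv 2 (pderiv 2 p) := by
  rw [laplacian, Fin.sum_univ_three]

theorem laplacian_dirDeriv (y : EuclideanSpace ℝ (Fin 3)) (p : MvPolynomial (Fin 3) ℂ) :
    laplacian (dirDeriv y p) = dirDeriv y (laplacian p) := by
  simp only [laplacian_apply, dirDeriv_apply, map_add, Derivation.leibniz, smul_eq_mul,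
    MvPolynomial.pderiv_C, mul_zero, add_zero]
  rw [pderiv_comm 1 0 p, pderiv_comm 2 0 p, pderiv_comm 2 1 p, pderiv_comm 1 0 (pderiv 0 p),
    pderiv_comm 2 0 (pderiv 0 p), pderiv_comm 2 1 (pderiv 1 p), pderiv_comm 0 1 (pderiv 1 p),
    pderiv_comm 0 2 (pderiv 2 p), pderiv_comm 1 2 (pderiv 2 p), pderiv_comm 0 1 p,
    pderiv_comm 0 2 p, pderiv_comm 1 2 p]

theorem laplacian_linForm_mul (y : EuclideanSpace ℝ (Fin 3)) (p : MvPolynomial (Fin 3) ℂ) :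
    laplacian (linForm y * p) = 2 * dirDeriv y p + linForm y * laplacian p := by
  simp only [laplacian_apply, dirDeriv_apply, linForm, map_add, Derivation.leibniz, smul_eq_mul,
    MvPolynomial.pderiv_C, MvPolynomial.pderiv_X_self, mul_zero, add_zero, zero_add, mul_one,
    MvPolynomial.pderiv_X_of_ne (show (0 : Fin 3) ≠ 1 by decide),
    MvPolynomial.pderiv_X_of_ne (show (0 : Fin 3) ≠ 2 by decide),
    MvPolynomial.pderiv_X_of_ne (show (1 : Fin 3) ≠ 0 by decide),
    MvPolynomial.pderiv_X_of_ne (show (1 : Fin 3) ≠ 2 by decide),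
    MvPolynomial.pderiv_X_of_ne (show (2 : Fin 3) ≠ 0 by decide),
    MvPolynomial.pderiv_X_of_ne (show (2 : Fin 3) ≠ 1 by decide)]
  ring

/-- The `6` is the Laplacian of `|x|²`; the `4 d` is the cross term `4 x · ∇p`, by Euler's identity.
-/
theorem laplacian_normSqForm_mul {p : MvPolynomial (Fin 3) ℂ} {d : ℕ} (hp : p.IsHomogeneous d) :
    laplacian (normSqForm * p) = (4 * (d : MvPolynomial (Fin 3) ℂ) + 6) * p
      + normSqForm * laplacian p := by
  have he := hp.sum_X_mul_pderiv
  rw [Fin.sum_univ_three, nsmul_eq_mul] at he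
  simp only [laplacian_apply, normSqForm, sq, map_add, Derivation.leibniz, smul_eq_mul,
    MvPolynomial.pderiv_X_self, mul_zero, add_zero, zero_add, mul_one,
    MvPolynomial.pderiv_X_of_ne (show (0 : Fin 3) ≠ 1 by decide),
    MvPolynomial.pderiv_X_of_ne (show (0 : Fin 3) ≠ 2 by decide),
    MvPolynomial.pderiv_X_of_ne (show (1 : Fin 3) ≠ 0 by decide),
    MvPolynomial.pderiv_X_of_ne (show (1 : Fin 3) ≠ 2 by decide),
    MvPolynomial.pderiv_X_of_ne (show (2 : Fin 3) ≠ 0 by decide),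
    MvPolynomial.pderiv_X_of_ne (show (2 : Fin 3) ≠ 1 by decide)]
  linear_combination 4 * he

theorem dirDeriv_linForm {y : EuclideanSpace ℝ (Fin 3)} (hy : ‖y‖ = 1) :
    dirDeriv y (linForm y) = 1 := by
  have h : (y 0 : ℂ) ^ 2 + (y 1 : ℂ) ^ 2 + (y 2 : ℂ) ^ 2 = 1 := by
    have h2 := EuclideanSpace.norm_sq_eq y
    rw [hy, Fin.sum_univ_three] at h2
    simp only [Real.norm_eq_abs, sq_abs] at h2
    exact_mod_cast h2.symm.trans (by norm_num)
  have h' := congrArg (C (σ := Fin 3)) h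
  simp only [map_add, map_pow, map_one] at h'
  simp only [dirDeriv_apply, linForm, map_add, Derivation.leibniz, smul_eq_mul,
    MvPolynomial.pderiv_C, MvPolynomial.pderiv_X_self, mul_zero, add_zero, zero_add, mul_one,
    MvPolynomial.pderiv_X_of_ne (show (0 : Fin 3) ≠ 1 by decide),
    MvPolynomial.pderiv_X_of_ne (show (0 : Fin 3) ≠ 2 by decide),
    MvPolynomial.pderiv_X_of_ne (show (1 : Fin 3) ≠ 0 by decide),
    MvPolynomial.pderiv_X_of_ne (show (1 : Fin 3) ≠ 2 by decide),
    MvPolynomial.pderiv_X_of_ne (show (2 : Fin 3) ≠ 0 by decide),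
    MvPolynomial.pderiv_X_of_ne (show (2 : Fin 3) ≠ 1 by decide)]
  linear_combination h'

theorem dirDeriv_normSqForm (y : EuclideanSpace ℝ (Fin 3)) :
    dirDeriv y normSqForm = 2 * linForm y := by
  simp only [dirDeriv_apply, normSqForm, linForm, sq, map_add, Derivation.leibniz, smul_eq_mul,
    MvPolynomial.pderiv_X_self, mul_zero, add_zero, zero_add, mul_one,
    MvPolynomial.pderiv_X_of_ne (show (0 : Fin 3) ≠ 1 by decide),
    MvPolynomial.pderiv_X_of_ne (show (0 : Fin 3) ≠ 2 by decide),
    MvPolynomial.pderiv_X_of_ne (show (1 : Fin 3) ≠ 0 by decide),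
    MvPolynomial.pderiv_X_of_ne (show (1 : Fin 3) ≠ 2 by decide),
    MvPolynomial.pderiv_X_of_ne (show (2 : Fin 3) ≠ 0 by decide),
    MvPolynomial.pderiv_X_of_ne (show (2 : Fin 3) ≠ 1 by decide)]
  ring

/-- The solid zonal harmonic `|x| ^ n P_n (⟪x, y⟫ / |x|)`. -/
def zonal (y : EuclideanSpace ℝ (Fin 3)) : ℕ → MvPolynomial (Fin 3) ℂ
  | 0 => 1
  | 1 => linForm y
  | n + 2 => C (1 / ((n : ℂ) + 2)) * (C (2 * (n : ℂ) + 3) * (linForm y * zonal y (n + 1))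
      - C ((n : ℂ) + 1) * (normSqForm * zonal y n))

theorem zonal_zero (y : EuclideanSpace ℝ (Fin 3)) : zonal y 0 = 1 := by rw [zonal]

theorem zonal_one (y : EuclideanSpace ℝ (Fin 3)) : zonal y 1 = linForm y := by rw [zonal]

theorem natCast_add_two_ne_zero (n : ℕ) : (n : MvPolynomial (Fin 3) ℂ) + 2 ≠ 0 := by
  exact_mod_cast (Nat.succ_ne_zero (n + 1))

theorem zonal_add_two (y : EuclideanSpace ℝ (Fin 3)) (n : ℕ) :
    ((n : MvPolynomial (Fin 3) ℂ) + 2) * zonal y (n + 2) =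
      (2 * n + 3) * (linForm y * zonal y (n + 1)) - (n + 1) * (normSqForm * zonal y n) := by
  have hn : (n : ℂ) + 2 ≠ 0 := by exact_mod_cast (Nat.succ_ne_zero (n + 1))
  have h1 : (C ((n : ℂ) + 2) : MvPolynomial (Fin 3) ℂ) * C (1 / ((n : ℂ) + 2)) = 1 := by
    rw [← map_mul, mul_one_div_cancel hn, map_one]
  rw [zonal, ← mul_assoc]
  have h2 : (C ((n : ℂ) + 2) : MvPolynomial (Fin 3) ℂ) = n + 2 := by
    rw [map_add, map_natCast, map_ofNat]
  rw [← h2, h1, one_mul]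
  simp only [map_add, map_mul, map_natCast, map_ofNat, map_one]

theorem isHomogeneous_linForm (y : EuclideanSpace ℝ (Fin 3)) : (linForm y).IsHomogeneous 1 :=
  ((((MvPolynomial.isHomogeneous_C_mul_X _ _)).add (MvPolynomial.isHomogeneous_C_mul_X _ _)).add
    (MvPolynomial.isHomogeneous_C_mul_X _ _))

theorem isHomogeneous_normSqForm : normSqForm.IsHomogeneous 2 :=
  ((MvPolynomial.isHomogeneous_X_pow _ _).add (MvPolynomial.isHomogeneous_X_pow _ _)).add
    (MvPolynomial.isHomogeneous_X_pow _ _)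

theorem isHomogeneous_zonal (y : EuclideanSpace ℝ (Fin 3)) (n : ℕ) :
    (zonal y n).IsHomogeneous n := by
  induction n using Nat.twoStepInduction with
  | zero => rw [zonal_zero]; exact MvPolynomial.isHomogeneous_one _ _
  | one => rw [zonal_one]; exact isHomogeneous_linForm y
  | more n h0 h1 =>
    rw [zonal]
    refine MvPolynomial.IsHomogeneous.C_mul (.sub (.C_mul ?_ _) (.C_mul ?_ _)) _
    · simpa [add_comm, add_left_comm] using (isHomogeneous_linForm y).mul h1
    · simpa [add_comm] using isHomogeneous_normSqForm.mul h0

/-- The homogeneous analogue of an Appell sequence, obtained by differentiating Bonnet's recursion.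
It serves both for harmonicity and for lowering the degree in the reproducing formula. -/
theorem dirDeriv_zonal {y : EuclideanSpace ℝ (Fin 3)} (hy : ‖y‖ = 1) (n : ℕ) :
    dirDeriv y (zonal y (n + 1)) = ((n : MvPolynomial (Fin 3) ℂ) + 1) * zonal y n := by
  induction n using Nat.strong_induction_on with
  | _ n ih =>
    match n with
    | 0 => simp [zonal_zero, zonal_one, dirDeriv_linForm hy]
    | 1 =>
      apply mul_left_cancel₀ (natCast_add_two_ne_zero 0)
      have e := congrArg (dirDeriv y) (zonal_add_two y 0)
      simp only [Nat.cast_zero, zero_add, zonal_zero, zonal_one, mul_one, one_mul, mul_zero,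
        map_sub, Derivation.leibniz, smul_eq_mul, dirDeriv_linForm hy, dirDeriv_normSqForm] at e
      have h2 : dirDeriv y 2 = 0 := by exact_mod_cast (dirDeriv y).map_natCast 2
      have h3 : dirDeriv y 3 = 0 := by exact_mod_cast (dirDeriv y).map_natCast 3
      rw [h2, h3] at e
      simp only [zonal_one, Nat.cast_zero, Nat.cast_one]
      linear_combination e
    | n + 2 =>
      apply mul_left_cancel₀ (natCast_add_two_ne_zero (n + 1))
      have e := congrArg (dirDeriv y) (zonal_add_two y (n + 1))
      have h2 : dirDeriv y 2 = 0 := by exact_mod_cast (dirDeriv y).map_natCast 2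
      have h3 : dirDeriv y 3 = 0 := by exact_mod_cast (dirDeriv y).map_natCast 3
      have hn : dirDeriv y (n : MvPolynomial (Fin 3) ℂ) = 0 := (dirDeriv y).map_natCast n
      have i1 := ih (n + 1) (by omega)
      have i0 := ih n (by omega)
      have e0 := zonal_add_two y n
      simp only [Nat.cast_add, Nat.cast_one, map_sub, map_add, Derivation.leibniz, smul_eq_mul,
        dirDeriv_linForm hy, dirDeriv_normSqForm, h2, h3, hn, Derivation.map_one_eq_zero,
        mul_zero, add_zero, mul_one] at e i1
      rw [show n + 1 + 1 = n + 2 from rfl] at e i1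
      rw [i1, i0] at e
      push_cast
      linear_combination e - ((n : MvPolynomial (Fin 3) ℂ) + 2) * e0

/-- In the recursion the two surviving terms are `2 (2 n + 3) (n + 1) Z_n` and `(n + 1) (4 n + 6)
Z_n`, which cancel. -/
theorem laplacian_zonal {y : EuclideanSpace ℝ (Fin 3)} (hy : ‖y‖ = 1) (n : ℕ) :
    laplacian (zonal y n) = 0 := by
  have hL : ∀ (m : ℕ) (p : MvPolynomial (Fin 3) ℂ), laplacian (m * p) = m * laplacian p := by
    intro m p
    simp only [laplacian_apply, Derivation.leibniz, Derivation.map_natCast, smul_eq_mul, mul_zero,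
      add_zero]
    ring
  have hS : ∀ p q : MvPolynomial (Fin 3) ℂ, laplacian (p - q) = laplacian p - laplacian q := by
    intro p q
    simp only [laplacian_apply, map_sub]
    ring
  have h1 : ∀ i : Fin 3, pderiv i (1 : MvPolynomial (Fin 3) ℂ) = 0 := fun i =>
    Derivation.map_one_eq_zero _
  induction n using Nat.twoStepInduction with
  | zero => simp [zonal_zero, laplacian_apply, h1]
  | one =>
    have := laplacian_linForm_mul y 1
    simpa [zonal_one, laplacian_apply, h1, dirDeriv_apply] using this
  | more n i0 i1 =>
    apply mul_left_cancel₀ (natCast_add_two_ne_zero n)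
    have e := congrArg laplacian (zonal_add_two y n)
    rw [show (n : MvPolynomial (Fin 3) ℂ) + 2 = ((n + 2 : ℕ) : MvPolynomial (Fin 3) ℂ) by
      push_cast; ring, show 2 * (n : MvPolynomial (Fin 3) ℂ) + 3 = ((2 * n + 3 : ℕ) :
      MvPolynomial (Fin 3) ℂ) by push_cast; ring, show (n : MvPolynomial (Fin 3) ℂ) + 1 =
      ((n + 1 : ℕ) : MvPolynomial (Fin 3) ℂ) by push_cast; ring, hS, hL, hL, hL,
      laplacian_linForm_mul, laplacian_normSqForm_mul (isHomogeneous_zonal y n), i0, i1,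
      dirDeriv_zonal hy] at e
    push_cast at e
    linear_combination e

theorem realEval_linForm (y x : EuclideanSpace ℝ (Fin 3)) :
    realEval (linForm y) x = ((inner ℝ x y : ℝ) : ℂ) := by
  simp [realEval, linForm, PiLp.inner_apply, Fin.sum_univ_three]

theorem realEval_normSqForm (x : S2) : realEval normSqForm x = 1 := by
  have h2 := EuclideanSpace.norm_sq_eq (x : EuclideanSpace ℝ (Fin 3))
  rw [mem_sphere_zero_iff_norm.1 x.2, Fin.sum_univ_three] at h2
  simp only [Real.norm_eq_abs, sq_abs] at h2
  simp only [realEval, normSqForm, map_add, map_pow, MvPolynomial.eval_X]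
  exact_mod_cast h2.symm.trans (by norm_num)

theorem realEval_zonal (y : EuclideanSpace ℝ (Fin 3)) (n : ℕ) (x : S2) :
    realEval (zonal y n) x =
      (((legendre n).eval (inner ℝ (x : EuclideanSpace ℝ (Fin 3)) y) : ℝ) : ℂ) := by
  induction n using Nat.twoStepInduction with
  | zero => simp [zonal_zero, legendre_zero, realEval]
  | one => simp [zonal_one, legendre_one, realEval_linForm]
  | more n i0 i1 =>
    have hn : (n : ℂ) + 2 ≠ 0 := by exact_mod_cast (Nat.succ_ne_zero (n + 1))
    apply mul_left_cancel₀ hn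
    have e := congrArg (fun p => realEval p x) (zonal_add_two y n)
    have hc : ∀ m : ℕ, realEval (m : MvPolynomial (Fin 3) ℂ) x = m := fun m => by simp [realEval]
    have h1 : realEval 1 x = 1 := by simp [realEval]
    have h2 : realEval 2 x = 2 := by simp [realEval]
    have h3 : realEval 3 x = 3 := by simp [realEval]
    simp only [realEval_mul, realEval_add, realEval_sub, hc, h1, h2, h3, realEval_linForm,
      realEval_normSqForm, i0, i1] at e
    rw [e]
    have h := congrArg (fun z : ℝ => (z : ℂ))
      (legendre_add_two n (inner ℝ (x : EuclideanSpace ℝ (Fin 3)) y))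
    push_cast at h
    rw [h]
    ring

/-! ### Orthogonality and the reproducing property of zonal harmonics -/

theorem sphereIntegral_normSqForm_mul (p : MvPolynomial (Fin 3) ℂ) :
    sphereIntegral (normSqForm * p) = sphereIntegral p := by
  simp only [sphereIntegral, realEval_mul, realEval_normSqForm, one_mul]

/-- Green's identity: Euler's formula writes `m q` as `∑ x_i ∂_i q`, and the divergence theorem
moves each `x_i` into a derivative of `p ∂_i q`, of degree `l + m - 1`. The right-hand side is
symmetric in `p` and `q`, whence the orthogonality of different degrees. -/
theorem sphereIntegral_mul_degree {p q : MvPolynomial (Fin 3) ℂ} {l m : ℕ}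
    (hp : p.IsHomogeneous l) (hq : q.IsHomogeneous m) (hΔ : laplacian q = 0) :
    ((l : ℂ) + m + 1) * (m * sphereIntegral (p * q)) =
      sphereIntegral (∑ i, pderiv i p * pderiv i q) := by
  have he := hq.sum_X_mul_pderiv
  cases m with
  | zero =>
    have h0 : ∀ i, pderiv i q = 0 := by
      rw [← MvPolynomial.totalDegree_zero_iff_isHomogeneous,
        MvPolynomial.totalDegree_eq_zero_iff_eq_C] at hq
      intro i
      rw [hq]
      simp
    simp [h0, sphereIntegral, realEval]
  | succ m =>
    have h1 : ∀ i, ((l : ℂ) + (m + 1 : ℕ) + 1) * sphereIntegral (X i * (p * pderiv i q)) =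
        sphereIntegral (pderiv i p * pderiv i q) + sphereIntegral (p * pderiv i (pderiv i q)) := by
      intro i
      have hd : (p * pderiv i q).IsHomogeneous (l + m) := by
        simpa using hp.mul (hq.pderiv (i := i))
      have := sphereIntegral_X_mul hd i
      rw [Derivation.leibniz, smul_eq_mul, smul_eq_mul, sphereIntegral_add] at this
      rw [mul_comm (pderiv i p), add_comm (sphereIntegral _), ← this]
      push_cast
      ring
    have h2 : ((m + 1 : ℕ) : ℂ) * sphereIntegral (p * q) =
        ∑ i, sphereIntegral (X i * (p * pderiv i q)) := by
      rw [← sphereIntegral_C_mul, ← sphereIntegral_sum]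
      congr 1
      simp_rw [mul_left_comm _ p, ← Finset.mul_sum]
      rw [he, nsmul_eq_mul]
      simp
    have h3 : ∑ i, sphereIntegral (p * pderiv i (pderiv i q)) = 0 := by
      rw [← sphereIntegral_sum, ← Finset.mul_sum]
      have : ∑ i, pderiv i (pderiv i q) = 0 := hΔ
      rw [this, mul_zero]
      simp [sphereIntegral, realEval]
    rw [h2, Finset.mul_sum, Finset.sum_congr rfl fun i _ => h1 i, Finset.sum_add_distrib, h3,
      add_zero, sphereIntegral_sum]

theorem sphereIntegral_mul_eq_zero {p q : MvPolynomial (Fin 3) ℂ} {l m : ℕ} (hlm : l ≠ m)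
    (hp : p.IsHomogeneous l) (hq : q.IsHomogeneous m) (hpΔ : laplacian p = 0)
    (hqΔ : laplacian q = 0) : sphereIntegral (p * q) = 0 := by
  have h1 := sphereIntegral_mul_degree hp hq hqΔ
  have h2 := sphereIntegral_mul_degree hq hp hpΔ
  have h3 : ∑ i, pderiv i q * pderiv i p = ∑ i, pderiv i p * pderiv i q :=
    Finset.sum_congr rfl fun i _ => mul_comm _ _
  rw [h3, ← h1, mul_comm q p] at h2
  have h4 : ((l : ℂ) + m + 1) * ((l - m) * sphereIntegral (p * q)) = 0 := by
    linear_combination h2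
  have h5 : (l : ℂ) + m + 1 ≠ 0 := by exact_mod_cast Nat.succ_ne_zero (l + m)
  have h6 : (l : ℂ) - m ≠ 0 := sub_ne_zero.2 (by exact_mod_cast hlm)
  exact (mul_eq_zero.1 ((mul_eq_zero.1 h4).resolve_left h5)).resolve_left h6

theorem sphereIntegral_one : sphereIntegral 1 = 4 * Real.pi := by
  have h : sphereIntegral 1 = ((surfaceMeasure.real Set.univ : ℝ) : ℂ) := by
    simp [sphereIntegral, realEval]
  rw [h, Measure.toSphere_real_apply_univ, measureReal_def, EuclideanSpace.volume_ball_fin_three]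
  rw [ENNReal.toReal_mul, ENNReal.toReal_ofReal (by have := Real.pi_pos; positivity)]
  simp
  ring

theorem sphereIntegral_linForm_mul (y : EuclideanSpace ℝ (Fin 3)) {p : MvPolynomial (Fin 3) ℂ}
    {d : ℕ} (hp : p.IsHomogeneous d) :
    ((d : ℂ) + 2) * sphereIntegral (linForm y * p) = sphereIntegral (dirDeriv y p) := by
  rw [dirDeriv_apply, sphereIntegral_add, sphereIntegral_add, sphereIntegral_C_mul,
    sphereIntegral_C_mul, sphereIntegral_C_mul, ← sphereIntegral_X_mul hp,
    ← sphereIntegral_X_mul hp, ← sphereIntegral_X_mul hp]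
  have h : linForm y * p = C (y 0 : ℂ) * (X 0 * p) + C (y 1 : ℂ) * (X 1 * p)
      + C (y 2 : ℂ) * (X 2 * p) := by
    rw [linForm]
    ring
  rw [h, sphereIntegral_add, sphereIntegral_add, sphereIntegral_C_mul, sphereIntegral_C_mul,
    sphereIntegral_C_mul]
  ring

theorem isHomogeneous_dirDeriv (y : EuclideanSpace ℝ (Fin 3)) {p : MvPolynomial (Fin 3) ℂ}
    {d : ℕ} (hp : p.IsHomogeneous (d + 1)) : (dirDeriv y p).IsHomogeneous d := by
  rw [dirDeriv_apply]
  have h : ∀ i, (pderiv i p).IsHomogeneous d := fun i => by simpa using hp.pderiv (i := i)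
  exact (((h 0).C_mul _).add ((h 1).C_mul _)).add ((h 2).C_mul _)

theorem realEval_dirDeriv_self (y : EuclideanSpace ℝ (Fin 3)) {p : MvPolynomial (Fin 3) ℂ}
    {d : ℕ} (hp : p.IsHomogeneous d) : realEval (dirDeriv y p) y = d * realEval p y := by
  have he := congrArg (fun q => realEval q y) hp.sum_X_mul_pderiv
  simp only [Fin.sum_univ_three, nsmul_eq_mul, realEval_add, realEval_mul, realEval_X] at he
  have hc : realEval (d : MvPolynomial (Fin 3) ℂ) y = d := by simp [realEval]
  rw [hc] at he
  rw [← he, dirDeriv_apply]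
  simp only [realEval_add, realEval_mul, realEval_C]

/-- Induction on the degree: Bonnet's recursion and orthogonality replace `Z_{l+1}` by `⟪x, y⟫ Z_l`,
the divergence theorem turns the factor `⟪x, y⟫` into the derivative along `y`, and that derivative
of `q` is harmonic of degree `l` with value `(l + 1) q(y)` at `y`. -/
theorem sphereIntegral_zonal_mul {y : EuclideanSpace ℝ (Fin 3)} (hy : ‖y‖ = 1) (l : ℕ)
    {q : MvPolynomial (Fin 3) ℂ} (hq : q.IsHomogeneous l) (hΔ : laplacian q = 0) :
    (2 * (l : ℂ) + 1) * sphereIntegral (zonal y l * q) = 4 * Real.pi * realEval q y := by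
  induction l generalizing q with
  | zero =>
    rw [← MvPolynomial.totalDegree_zero_iff_isHomogeneous,
      MvPolynomial.totalDegree_eq_zero_iff_eq_C] at hq
    rw [hq, zonal_zero, mul_comm 1, sphereIntegral_C_mul, sphereIntegral_one, realEval_C]
    push_cast
    ring
  | succ l ih =>
    have hlin : (2 * (l : ℂ) + 3) * sphereIntegral (linForm y * (zonal y l * q)) =
        sphereIntegral (zonal y l * dirDeriv y q) := by
      have h1 := sphereIntegral_linForm_mul y ((isHomogeneous_zonal y l).mul hq)
      rw [Derivation.leibniz, smul_eq_mul, smul_eq_mul, sphereIntegral_add] at h1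
      have h2 : sphereIntegral (q * dirDeriv y (zonal y l)) = 0 := by
        cases l with
        | zero => simp [zonal_zero, sphereIntegral, realEval]
        | succ m =>
          rw [dirDeriv_zonal hy]
          have : q * (((m : MvPolynomial (Fin 3) ℂ) + 1) * zonal y m) =
              C ((m : ℂ) + 1) * (q * zonal y m) := by
            simp
            ring
          rw [this, sphereIntegral_C_mul, sphereIntegral_mul_eq_zero (by omega) hq
            (isHomogeneous_zonal y m) hΔ (laplacian_zonal hy m), mul_zero]
      rw [h2, add_zero] at h1
      rw [← h1]
      push_cast
      ring
    have hD := ih (isHomogeneous_dirDeriv y hq) (by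
      rw [laplacian_dirDeriv, hΔ, map_zero])
    rw [realEval_dirDeriv_self y hq] at hD
    have hrec : ((l : ℂ) + 1) * sphereIntegral (zonal y (l + 1) * q) =
        (2 * l + 1) * sphereIntegral (linForm y * (zonal y l * q)) := by
      cases l with
      | zero => simp [zonal_zero, zonal_one]
      | succ m =>
        have e : C ((m : ℂ) + 2) * (zonal y (m + 2) * q) =
            C (2 * (m : ℂ) + 3) * (linForm y * (zonal y (m + 1) * q))
              - C ((m : ℂ) + 1) * (normSqForm * (zonal y m * q)) := by
          simp only [map_add, map_mul, map_natCast, map_ofNat, map_one]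
          linear_combination q * zonal_add_two y m
        have e2 := congrArg sphereIntegral e
        rw [sphereIntegral_C_mul, sphereIntegral_sub, sphereIntegral_C_mul, sphereIntegral_C_mul,
          sphereIntegral_normSqForm_mul, sphereIntegral_mul_eq_zero (by omega)
            (isHomogeneous_zonal y m) hq (laplacian_zonal hy m) hΔ] at e2
        push_cast
        linear_combination e2
    have h5 : (l : ℂ) + 1 ≠ 0 := by exact_mod_cast Nat.succ_ne_zero l
    apply mul_left_cancel₀ h5
    push_cast at hD ⊢
    linear_combination (2 * (l : ℂ) + 3) * hrec + (2 * (l : ℂ) + 1) * hlin + hD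

theorem sphereIntegral_zonal_mul_of_ne {y : EuclideanSpace ℝ (Fin 3)} (hy : ‖y‖ = 1) {l m : ℕ}
    (hlm : m ≠ l) {q : MvPolynomial (Fin 3) ℂ} (hq : q.IsHomogeneous l) (hΔ : laplacian q = 0) :
    sphereIntegral (zonal y m * q) = 0 :=
  sphereIntegral_mul_eq_zero hlm (isHomogeneous_zonal y m) hq (laplacian_zonal hy m) hΔ

/-! ### The reproducing kernel -/

/-- The kernel `(4 π)⁻¹ ∑_{l ≤ L} (2 l + 1) P_l(⟪x, y⟫)`. -/
def harmonicKernel (L : ℕ) (x y : S2) : ℝ :=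
  (kernelPoly L).eval (inner ℝ (x : EuclideanSpace ℝ (Fin 3)) y) / (4 * Real.pi)

theorem norm_coe_S2 (x : S2) : ‖(x : EuclideanSpace ℝ (Fin 3))‖ = 1 :=
  mem_sphere_zero_iff_norm.1 x.2

theorem harmonicKernel_eq_sum (L : ℕ) (x y : S2) : (harmonicKernel L x y : ℂ) =
    ∑ l ∈ Finset.range (L + 1), (2 * (l : ℂ) + 1) / (4 * Real.pi) * realEval (zonal y l) x := by
  simp only [realEval_zonal, harmonicKernel, kernelPoly_eval]
  push_cast
  rw [Finset.sum_div]
  exact Finset.sum_congr rfl fun l _ => by ring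

theorem harmonicKernel_comm (L : ℕ) (x y : S2) : harmonicKernel L x y = harmonicKernel L y x := by
  rw [harmonicKernel, harmonicKernel, real_inner_comm]

theorem harmonicKernel_self (L : ℕ) (x : S2) :
    harmonicKernel L x x = ((L : ℝ) + 1) ^ 2 / (4 * Real.pi) := by
  rw [harmonicKernel, real_inner_self_eq_norm_sq, norm_coe_S2, one_pow, kernelPoly_eval_one]

theorem harmonicKernel_mem (L : ℕ) (y : S2) :
    (fun x => (harmonicKernel L x y : ℂ)) ∈ harmonicSpace L := by
  have h : (fun x => (harmonicKernel L x y : ℂ)) = ∑ l ∈ Finset.range (L + 1),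
      ((2 * (l : ℂ) + 1) / (4 * Real.pi)) • fun x : S2 => realEval (zonal y l) x := by
    ext x
    simp [harmonicKernel_eq_sum, Finset.sum_apply]
  rw [h]
  refine Submodule.sum_mem _ fun l hl => Submodule.smul_mem _ _ (Submodule.subset_span ?_)
  exact ⟨l, Nat.lt_succ_iff.1 (Finset.mem_range.1 hl), zonal y l, isHomogeneous_zonal _ l,
    laplacian_zonal (norm_coe_S2 y) l, fun x => rfl⟩

theorem continuous_of_mem_harmonicSpace {L : ℕ} {f : S2 → ℂ} (hf : f ∈ harmonicSpace L) :
    Continuous f := by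
  refine Submodule.span_induction (p := fun f _ => Continuous f) ?_ continuous_const
    (fun _ _ _ _ h1 h2 => h1.add h2) (fun c _ _ h => h.const_smul c) hf
  rintro f ⟨l, _, p, _, _, hp⟩
  have : f = fun x : S2 => realEval p x := funext hp
  rw [this]
  exact (continuous_realEval p).comp continuous_subtype_val

theorem harmonicKernel_reproducing {L : ℕ} {f : S2 → ℂ} (hf : f ∈ harmonicSpace L) (y : S2) :
    ∫ x, (harmonicKernel L x y : ℂ) * f x ∂surfaceMeasure = f y := by
  have hcont : ∀ {g : S2 → ℂ}, g ∈ harmonicSpace L →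
      Integrable (fun x => (harmonicKernel L x y : ℂ) * g x) surfaceMeasure := fun hg =>
    integrable_of_continuous ((continuous_of_mem_harmonicSpace (harmonicKernel_mem L y)).mul
      (continuous_of_mem_harmonicSpace hg))
  refine Submodule.span_induction (p := fun f _ =>
    ∫ x, (harmonicKernel L x y : ℂ) * f x ∂surfaceMeasure = f y) ?_ (by simp) ?_ ?_ hf
  · rintro f ⟨l, hl, p, hph, hpΔ, hp⟩
    have hf : f = fun x : S2 => realEval p x := funext hp
    subst hf
    have h1 : ∫ x, (harmonicKernel L x y : ℂ) * realEval p x ∂surfaceMeasure =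
        ∑ m ∈ Finset.range (L + 1), (2 * (m : ℂ) + 1) / (4 * Real.pi) *
          sphereIntegral (zonal y m * p) := by
      simp_rw [harmonicKernel_eq_sum, Finset.sum_mul, mul_assoc, ← realEval_mul]
      rw [integral_finsetSum _ fun m _ => (integrable_realEval _).const_mul _]
      simp_rw [integral_const_mul]
      rfl
    rw [h1, Finset.sum_eq_single l]
    · have h2 := sphereIntegral_zonal_mul (norm_coe_S2 y) l hph hpΔ
      have hπ : (Real.pi : ℂ) ≠ 0 := Complex.ofReal_ne_zero.2 Real.pi_ne_zero
      rw [div_mul_eq_mul_div, h2]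
      field_simp
    · intro m _ hml
      rw [sphereIntegral_zonal_mul_of_ne (norm_coe_S2 y) hml hph hpΔ, mul_zero]
    · intro h
      exact absurd (Finset.mem_range.2 (Nat.lt_succ_iff.2 hl)) h
  · intro f g hf hg h1 h2
    simp only [Pi.add_apply, mul_add]
    rw [integral_add (hcont hf) (hcont hg), h1, h2]
  · intro c f _ h
    simp only [Pi.smul_apply, smul_eq_mul, mul_left_comm _ c]
    rw [integral_const_mul, h]

/-- Uniqueness of reproducing kernels: each of the two kernels is reproduced by the other. The
explicit one is real and symmetric, which absorbs the conjugation. -/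
theorem IsReproducingKernel.eq_harmonicKernel {L : ℕ} {K : S2 → S2 → ℂ}
    (hK : IsReproducingKernel surfaceMeasure (harmonicSpace L) K) (x y : S2) :
    K x y = harmonicKernel L x y := by
  have h1 := harmonicKernel_reproducing (hK.mem y) x
  have h2 := hK.reproducing _ (harmonicKernel_mem L x) y
  rw [← h1, ← Complex.conj_ofReal, harmonicKernel_comm, h2, ← integral_conj]
  refine integral_congr_ae (Filter.Eventually.of_forall fun z => ?_)
  simp [mul_comm]

/-! ### Zonal integrals -/

/-- Both sides satisfy `(j + 3) a_{j+2} = (j + 1) a_j` with `a_0 = 4 π` and `a_1 = 0`. -/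
theorem sphereIntegral_linForm_pow {y : EuclideanSpace ℝ (Fin 3)} (hy : ‖y‖ = 1) (j : ℕ) :
    sphereIntegral (linForm y ^ j) = ((2 * Real.pi * ∫ t in (-1 : ℝ)..1, t ^ j : ℝ) : ℂ) := by
  induction j using Nat.twoStepInduction with
  | zero =>
    rw [pow_zero, sphereIntegral_one]
    simp
    ring
  | one =>
    have h := sphereIntegral_linForm_mul y (MvPolynomial.isHomogeneous_one (Fin 3) ℂ)
    rw [Derivation.map_one_eq_zero] at h
    have h0 : sphereIntegral 0 = 0 := by simp [sphereIntegral, realEval]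
    rw [h0, mul_one] at h
    simp only [pow_one]
    rw [(mul_eq_zero.1 h).resolve_left (by simp)]
    simp
  | more j h0 _ =>
    have hd : (linForm y ^ (j + 1)).IsHomogeneous (j + 1) := by
      simpa using (isHomogeneous_linForm y).pow (j + 1)
    have h := sphereIntegral_linForm_mul y hd
    rw [Derivation.leibniz_pow, dirDeriv_linForm hy, ← pow_succ'] at h
    have e : (j + 1) • linForm y ^ (j + 1 - 1) • (1 : MvPolynomial (Fin 3) ℂ) =
        MvPolynomial.C ((j : ℂ) + 1) * linForm y ^ j := by
      simp [nsmul_eq_mul]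
    rw [e, sphereIntegral_C_mul, h0] at h
    have hj : ((j : ℂ) + 3) ≠ 0 := by exact_mod_cast Nat.succ_ne_zero (j + 2)
    apply mul_left_cancel₀ hj
    have hr : ((j : ℝ) + 3) * (2 * Real.pi * ∫ t in (-1 : ℝ)..1, t ^ (j + 2)) =
        ((j : ℝ) + 1) * (2 * Real.pi * ∫ t in (-1 : ℝ)..1, t ^ j) := by
      rw [integral_pow, integral_pow]
      push_cast
      have h1 : (j : ℝ) + 1 ≠ 0 := by positivity
      have h3 : (j : ℝ) + 2 + 1 ≠ 0 := by positivity
      field_simp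
      ring
    have hr' := congrArg (fun z : ℝ => (z : ℂ)) hr
    push_cast at hr' h ⊢
    rw [hr', ← h]
    ring

theorem integral_polynomial_inner (p : Polynomial ℝ) (y : S2) :
    ∫ x : S2, p.eval (inner ℝ (x : EuclideanSpace ℝ (Fin 3)) y) ∂surfaceMeasure =
      2 * Real.pi * ∫ t in (-1 : ℝ)..1, p.eval t := by
  have hS : CompactSpace S2 := Metric.sphere.compactSpace _ _
  have hint : ∀ q : Polynomial ℝ, Integrable
      (fun x : S2 => q.eval (inner ℝ (x : EuclideanSpace ℝ (Fin 3)) y)) surfaceMeasure := fun q =>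
    Continuous.integrable_of_hasCompactSupport (by fun_prop) (HasCompactSupport.of_compactSpace _)
  induction p using Polynomial.induction_on' with
  | add p q hp hq =>
    simp only [Polynomial.eval_add]
    rw [integral_add (hint p) (hint q), hp, hq, intervalIntegral.integral_add
      (p.continuous.intervalIntegrable _ _) (q.continuous.intervalIntegrable _ _)]
    ring
  | monomial j a =>
    simp only [Polynomial.eval_monomial]
    rw [integral_const_mul, intervalIntegral.integral_const_mul]
    have h := sphereIntegral_linForm_pow (norm_coe_S2 y) j
    have h2 : sphereIntegral (linForm y ^ j) =
        ((∫ x : S2, (inner ℝ (x : EuclideanSpace ℝ (Fin 3)) y) ^ j ∂surfaceMeasure : ℝ) : ℂ) := by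
      rw [← integral_complex_ofReal]
      simp only [sphereIntegral, Complex.ofReal_pow, ← realEval_linForm]
      simp only [realEval, map_pow]
    rw [h2] at h
    rw [Complex.ofReal_injective h]
    ring

/-- Archimedes' hat-box theorem. -/
theorem integral_comp_inner {g : ℝ → ℝ} (hg : Continuous g) (y : S2) :
    ∫ x : S2, g (inner ℝ (x : EuclideanSpace ℝ (Fin 3)) y) ∂surfaceMeasure =
      2 * Real.pi * ∫ t in (-1 : ℝ)..1, g t := by
  have hS : CompactSpace S2 := Metric.sphere.compactSpace _ _
  have hmem : ∀ x : S2, inner ℝ (x : EuclideanSpace ℝ (Fin 3)) y ∈ Set.Icc (-1 : ℝ) 1 := fun x => by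
    have := abs_real_inner_le_norm (x : EuclideanSpace ℝ (Fin 3)) y
    rw [norm_coe_S2, norm_coe_S2, one_mul, abs_le] at this
    exact this
  have hint : ∀ q : ℝ → ℝ, Continuous q → Integrable
      (fun x : S2 => q (inner ℝ (x : EuclideanSpace ℝ (Fin 3)) y)) surfaceMeasure := fun q hq =>
    Continuous.integrable_of_hasCompactSupport (by fun_prop) (HasCompactSupport.of_compactSpace _)
  have hπ := Real.pi_pos
  set m := surfaceMeasure.real Set.univ
  have hm : 0 ≤ m := measureReal_nonneg
  refine eq_of_abs_sub_le_all fun ε hε => ?_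
  -- Weierstrass approximation within `δ` costs `δ m` on the sphere and `2 π · 2 δ` on the interval.
  set δ := ε / (m + 4 * Real.pi) with hδ
  have hδ0 : 0 < δ := by positivity
  obtain ⟨p, hp⟩ := exists_polynomial_near_of_continuousOn (-1) 1 g hg.continuousOn δ hδ0
  have h1 : |(∫ x : S2, p.eval (inner ℝ (x : EuclideanSpace ℝ (Fin 3)) y) ∂surfaceMeasure) -
      ∫ x : S2, g (inner ℝ (x : EuclideanSpace ℝ (Fin 3)) y) ∂surfaceMeasure| ≤ δ * m := by
    rw [← integral_sub (hint _ p.continuous) (hint _ hg)]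
    have := norm_integral_le_of_norm_le_const (μ := surfaceMeasure) (C := δ)
      (f := fun x : S2 => p.eval (inner ℝ (x : EuclideanSpace ℝ (Fin 3)) y)
        - g (inner ℝ (x : EuclideanSpace ℝ (Fin 3)) y))
      (Filter.Eventually.of_forall fun x => (hp _ (hmem x)).le)
    exact this
  have h2 : |(∫ t in (-1 : ℝ)..1, p.eval t) - ∫ t in (-1 : ℝ)..1, g t| ≤ δ * 2 := by
    rw [← intervalIntegral.integral_sub (p.continuous.intervalIntegrable _ _)
      (hg.intervalIntegrable _ _)]
    have := intervalIntegral.norm_integral_le_of_norm_le_const (a := (-1 : ℝ)) (b := 1)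
      (f := fun t => p.eval t - g t) (C := δ) (fun t ht => by
        rw [Set.uIoc_of_le (by norm_num)] at ht
        exact (hp t ⟨ht.1.le, ht.2⟩).le)
    rw [Real.norm_eq_abs] at this
    norm_num at this ⊢
    exact this
  rw [integral_polynomial_inner] at h1
  have h3 : δ * (m + 4 * Real.pi) = ε := by rw [hδ]; field_simp
  have h4 : |2 * Real.pi * (∫ t in (-1 : ℝ)..1, p.eval t) - 2 * Real.pi * ∫ t in (-1 : ℝ)..1, g t|
      ≤ 2 * Real.pi * (δ * 2) := by
    rw [← mul_sub, abs_mul, abs_of_pos (by positivity)]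
    gcongr
  rw [abs_le] at *
  constructor <;> linarith [h1.1, h1.2, h4.1, h4.2]

/-- The reproducing formula applied to the zonal harmonic itself, whose value at its pole is `P_l(1)
= 1`. -/
theorem integral_legendre_sq (l : ℕ) :
    ∫ t in (-1 : ℝ)..1, (legendre l).eval t ^ 2 = 2 / (2 * l + 1) := by
  let y : S2 := ⟨EuclideanSpace.single 0 1, by simp⟩
  have h1 := integral_comp_inner (g := fun t => (legendre l).eval t ^ 2) (by fun_prop) y
  have h2 := sphereIntegral_zonal_mul (norm_coe_S2 y) l (isHomogeneous_zonal _ l)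
    (laplacian_zonal (norm_coe_S2 y) l)
  have h3 : sphereIntegral (zonal y l * zonal y l) = ((∫ x : S2, (legendre l).eval
      (inner ℝ (x : EuclideanSpace ℝ (Fin 3)) y) ^ 2 ∂surfaceMeasure : ℝ) : ℂ) := by
    rw [← integral_complex_ofReal]
    simp only [sphereIntegral, realEval_mul, realEval_zonal, sq, Complex.ofReal_mul]
  rw [h3, realEval_zonal, real_inner_self_eq_norm_sq, norm_coe_S2, one_pow, legendre_eval_one,
    h1] at h2
  have h4 : (2 * (l : ℝ) + 1) * (2 * Real.pi * ∫ t in (-1 : ℝ)..1, (legendre l).eval t ^ 2) =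
      4 * Real.pi := by
    apply Complex.ofReal_injective
    push_cast at h2 ⊢
    simpa using h2
  have hπ := Real.pi_pos
  rw [eq_div_iff (by positivity)]
  apply mul_left_cancel₀ (mul_pos two_pos hπ).ne'
  linarith

theorem abs_kernelIntegral_sub_log_le (L : ℕ) :
    |kernelIntegral L - 2 / Real.pi * ((L + 1) * Real.log (L + 1))| ≤ 8 * ((L : ℝ) + 1) :=
  abs_kernelIntegral_sub_le integral_legendre_sq L

/-! ### Pairs of points of a point process -/

section Pairs

variable {Λ Ω : Type*} [MeasurableSpace Λ] [MeasurableSpace Ω]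

/-- The intensity measure of the ordered pairs of different points. -/
def pairMeasure (P : Measure Ω) {N : ℕ} (X : Ω → Fin N → Λ) : Measure (Λ × Λ) :=
  ∑ p : Fin N × Fin N, if p.1 ≠ p.2 then P.map (fun ω => (X ω p.1, X ω p.2)) else 0

theorem pairMeasure_apply (P : Measure Ω) {N : ℕ} {X : Ω → Fin N → Λ} (hX : Measurable X)
    {B : Set (Λ × Λ)} (hB : MeasurableSet B) : pairMeasure P X B =
      ∑ p : Fin N × Fin N, if p.1 ≠ p.2 then P {ω | (X ω p.1, X ω p.2) ∈ B} else 0 := by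
  rw [pairMeasure, Measure.finsetSum_apply]
  refine Finset.sum_congr rfl fun p _ => ?_
  split_ifs with h
  · rw [Measure.map_apply (by fun_prop) hB]
    rfl
  · rfl

instance isFiniteMeasure_pairMeasure (P : Measure Ω) [IsFiniteMeasure P] {N : ℕ}
    (X : Ω → Fin N → Λ) : IsFiniteMeasure (pairMeasure P X) := by
  unfold pairMeasure
  have : ∀ p : Fin N × Fin N, IsFiniteMeasure
      (if p.1 ≠ p.2 then P.map (fun ω => (X ω p.1, X ω p.2)) else 0) := fun p => by
    split_ifs <;> infer_instance
  infer_instance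

theorem pairMeasure_prod_eq {μ : Measure Λ} [SigmaFinite μ] {P : Measure Ω} {N : ℕ}
    {X : Ω → Fin N → Λ} (hX : Measurable X) {ρ : (Fin 2 → Λ) → ℝ}
    (hρ : IsIntensityFunction μ P X ρ) {A B : Set Λ} (hA : MeasurableSet A) (hB : MeasurableSet B)
    (hAB : Disjoint A B) : pairMeasure P X (A ×ˢ B) =
      ((μ.prod μ).withDensity fun z => ENNReal.ofReal (ρ ![z.1, z.2])) (A ×ˢ B) := by
  have hX' : ∀ i, Measurable fun ω => X ω i := fun i => by fun_prop
  have h := hρ.expectation ![A, B] (by simp [Fin.forall_fin_two, hA, hB])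
    (by simp [Fin.forall_fin_two, hAB, hAB.symm])
  rw [withDensity_apply _ (hA.prod hB)]
  have hr : ∫⁻ x in Set.univ.pi ![A, B], ENNReal.ofReal (ρ x) ∂(Measure.pi fun _ => μ) =
      ∫⁻ z in A ×ˢ B, ENNReal.ofReal (ρ ![z.1, z.2]) ∂(μ.prod μ) := by
    have hmp := (measurePreserving_finTwoArrow μ).symm
    rw [← hmp.setLIntegral_comp_preimage_emb (MeasurableEquiv.measurableEmbedding _)]
    congr 2
    ext z
    simp [Set.mem_pi, Fin.forall_fin_two]
  rw [← hr, ← h, pairMeasure_apply P hX (hA.prod hB)]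
  have hl : ∀ ω, ∏ i, numPoints (X ω) (![A, B] i) = ∑ p : Fin N × Fin N,
      {ω | X ω p.1 ∈ A ∧ X ω p.2 ∈ B}.indicator (fun _ => (1 : ℝ≥0∞)) ω := by
    intro ω
    rw [Fin.prod_univ_two]
    simp only [numPoints, Matrix.cons_val_zero, Matrix.cons_val_one]
    rw [Finset.sum_mul_sum, ← Finset.sum_product', Finset.univ_product_univ]
    refine Finset.sum_congr rfl fun p _ => ?_
    by_cases h1 : X ω p.1 ∈ A <;> by_cases h2 : X ω p.2 ∈ B <;> simp [h1, h2]
  have hm : ∀ p : Fin N × Fin N, MeasurableSet {ω | X ω p.1 ∈ A ∧ X ω p.2 ∈ B} := fun p =>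
    (hX' p.1 hA).inter (hX' p.2 hB)
  simp_rw [hl]
  rw [lintegral_finsetSum _ fun p _ => measurable_const.indicator (hm p)]
  refine Finset.sum_congr rfl fun p _ => ?_
  rw [lintegral_indicator_const (hm p), one_mul]
  split_ifs with hp
  · rfl
  · rw [not_not] at hp
    symm
    convert measure_empty (μ := P)
    ext ω
    simp only [Set.mem_ofPred_eq, Set.mem_empty_iff_false, iff_false, ← hp]
    exact fun h => Set.disjoint_left.1 hAB h.1 h.2

/-- Intensities are only prescribed on disjoint sets. Countably many rectangles over disjoint basic
open sets cover the complement of the diagonal, and on each of them the measures agree on all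
subrectangles. The diagonal is null for both: the points are almost surely distinct, and `ρ`
vanishes there. -/
theorem pairMeasure_eq [TopologicalSpace Λ] [SecondCountableTopology Λ] [T2Space Λ]
    [BorelSpace Λ] {μ : Measure Λ} [SigmaFinite μ] {P : Measure Ω} [IsFiniteMeasure P] {N : ℕ}
    {X : Ω → Fin N → Λ} (hX : IsSimpleProcess P X) {ρ : (Fin 2 → Λ) → ℝ}
    (hρ : IsIntensityFunction μ P X ρ) : pairMeasure P X =
      (μ.prod μ).withDensity fun z => ENNReal.ofReal (ρ ![z.1, z.2]) := by
  let b := TopologicalSpace.countableBasis Λ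
  let ι := {p : b × b // Disjoint (p.1 : Set Λ) (p.2 : Set Λ)}
  have : Countable b := (TopologicalSpace.countable_countableBasis Λ).to_subtype
  let s : Option ι → Set (Λ × Λ) := fun o =>
    o.elim (Set.diagonal Λ) fun p => (p.1.1 : Set Λ) ×ˢ (p.1.2 : Set Λ)
  have hbo : ∀ U : b, IsOpen (U : Set Λ) := fun U =>
    TopologicalSpace.isOpen_of_mem_countableBasis U.2
  have hcover : ⋃ o, s o = Set.univ := by
    refine Set.eq_univ_of_forall fun z => Set.mem_iUnion.2 ?_
    by_cases hz : z.1 = z.2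
    · exact ⟨none, hz⟩
    · obtain ⟨U, V, hU, hV, hzU, hzV, hUV⟩ := t2_separation hz
      have hb := TopologicalSpace.isBasis_countableBasis Λ
      obtain ⟨U', hU', hzU', hUU'⟩ := hb.exists_subset_of_mem_open hzU hU
      obtain ⟨V', hV', hzV', hVV'⟩ := hb.exists_subset_of_mem_open hzV hV
      exact ⟨some ⟨(⟨U', hU'⟩, ⟨V', hV'⟩), hUV.mono hUU' hVV'⟩, hzU', hzV'⟩
  refine Measure.ext_of_iUnion_eq_univ hcover fun o => ?_
  cases o with
  | none =>
    have hd : MeasurableSet (Set.diagonal Λ) := isClosed_diagonal.measurableSet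
    change Measure.restrict _ (Set.diagonal Λ) = Measure.restrict _ (Set.diagonal Λ)
    have h1 : pairMeasure P X (Set.diagonal Λ) = 0 := by
      rw [pairMeasure_apply P hX.measurable hd]
      refine Finset.sum_eq_zero fun p _ => ?_
      split_ifs with hp
      · have h0 : P {ω | ¬ Function.Injective (X ω)} = 0 := ae_iff.1 hX.simple
        refine measure_mono_null (fun ω hω => ?_) h0
        intro hinj
        exact hp (hinj hω)
      · rfl
    have h2 : ((μ.prod μ).withDensity fun z => ENNReal.ofReal (ρ ![z.1, z.2]))
        (Set.diagonal Λ) = 0 := by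
      rw [withDensity_apply _ hd]
      rw [setLIntegral_congr_fun (g := fun _ => 0) hd]
      · simp
      · intro z hz
        simp only
        rw [hρ.eq_zero, ENNReal.ofReal_zero]
        intro hinj
        have := @hinj 0 1 (by simpa using hz)
        simp at this
    rw [Measure.restrict_eq_zero.2 h1, Measure.restrict_eq_zero.2 h2]
  | some p =>
    change Measure.restrict _ ((p.1.1 : Set Λ) ×ˢ (p.1.2 : Set Λ)) =
      Measure.restrict _ ((p.1.1 : Set Λ) ×ˢ (p.1.2 : Set Λ))
    refine Measure.ext_prod fun {A B} hA hB => ?_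
    rw [Measure.restrict_apply (hA.prod hB), Measure.restrict_apply (hA.prod hB), Set.prod_inter_prod]
    exact pairMeasure_prod_eq hX.measurable hρ (hA.inter (hbo _).measurableSet)
      (hB.inter (hbo _).measurableSet) (p.2.mono Set.inter_subset_right Set.inter_subset_right)

/-- The expectation of a sum over ordered pairs of different points. -/
theorem integral_sum_pairs [TopologicalSpace Λ] [SecondCountableTopology Λ] [T2Space Λ]
    [BorelSpace Λ] {μ : Measure Λ} [SigmaFinite μ] {P : Measure Ω} [IsFiniteMeasure P] {N : ℕ}
    {X : Ω → Fin N → Λ} (hX : IsSimpleProcess P X) {ρ : (Fin 2 → Λ) → ℝ}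
    (hρ : IsIntensityFunction μ P X ρ) (hρm : Measurable fun z : Λ × Λ => ρ ![z.1, z.2])
    {f : Λ × Λ → ℝ} (hf : Measurable f) {M : ℝ} (hM : ∀ z, |f z| ≤ M) :
    ∑ p : Fin N × Fin N, (if p.1 ≠ p.2 then ∫ ω, f (X ω p.1, X ω p.2) ∂P else 0) =
      ∫ z, ρ ![z.1, z.2] * f z ∂(μ.prod μ) := by
  have hmeas := hX.measurable
  have h1 : ∫ z, f z ∂(pairMeasure P X) = ∫ z, ρ ![z.1, z.2] * f z ∂(μ.prod μ) := by
    rw [pairMeasure_eq hX hρ]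
    rw [integral_withDensity_eq_integral_toReal_smul hρm.ennreal_ofReal
      (Filter.Eventually.of_forall fun _ => ENNReal.ofReal_lt_top)]
    refine integral_congr_ae (Filter.Eventually.of_forall fun z => ?_)
    simp only [ENNReal.toReal_ofReal (hρ.nonneg _), smul_eq_mul]
  rw [← h1, pairMeasure, integral_finsetSum_measure]
  · refine Finset.sum_congr rfl fun p _ => ?_
    split_ifs with hp
    · rw [integral_map (by fun_prop) hf.aestronglyMeasurable]
    · simp
  · intro p _
    have : IsFiniteMeasure (if p.1 ≠ p.2 then P.map (fun ω => (X ω p.1, X ω p.2)) else 0) := by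
      split_ifs <;> infer_instance
    exact Integrable.of_bound hf.aestronglyMeasurable M (Filter.Eventually.of_forall hM)

end Pairs

/-! ### Distances between points on Hopf fibres -/

theorem norm_coe_S3 (z : S3) : ‖(z : EuclideanSpace ℂ (Fin 2))‖ = 1 :=
  mem_sphere_zero_iff_norm.1 z.2

theorem coe_rotate (t : ℝ) (z : S3) : (rotate t z : EuclideanSpace ℂ (Fin 2)) =
    Complex.exp (t * Complex.I) • (z : EuclideanSpace ℂ (Fin 2)) := rfl

theorem rotate_add (t u : ℝ) (z : S3) : rotate (t + u) z = rotate t (rotate u z) := by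
  apply Subtype.ext
  rw [coe_rotate, coe_rotate, coe_rotate, smul_smul, ← Complex.exp_add]
  push_cast
  ring_nf

/-- Distances on `S²` are thus functions of the modulus of the Hermitian product alone, the quantity
invariant under rotating both fibres. -/
theorem inner_hopf (z w : S3) :
    inner ℝ (hopf z : EuclideanSpace ℝ (Fin 3)) (hopf w) =
      2 * ‖inner ℂ (w : EuclideanSpace ℂ (Fin 2)) z‖ ^ 2 - 1 := by
  have hz := EuclideanSpace.norm_sq_eq (z : EuclideanSpace ℂ (Fin 2))
  have hw := EuclideanSpace.norm_sq_eq (w : EuclideanSpace ℂ (Fin 2))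
  rw [norm_coe_S3, Fin.sum_univ_two, ← Complex.normSq_eq_norm_sq, ← Complex.normSq_eq_norm_sq,
    Complex.normSq_apply, Complex.normSq_apply] at hz hw
  set z' := (z : EuclideanSpace ℂ (Fin 2)) with hz'
  set w' := (w : EuclideanSpace ℂ (Fin 2)) with hw'
  have h1 : (1 : ℝ) = ((z' 0).re * (z' 0).re + (z' 0).im * (z' 0).im
      + ((z' 1).re * (z' 1).re + (z' 1).im * (z' 1).im)) *
      ((w' 0).re * (w' 0).re + (w' 0).im * (w' 0).im
      + ((w' 1).re * (w' 1).re + (w' 1).im * (w' 1).im)) := by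
    rw [← hz, ← hw]; norm_num
  rw [PiLp.inner_apply, PiLp.inner_apply, Fin.sum_univ_three, Fin.sum_univ_two,
    ← Complex.normSq_eq_norm_sq, Complex.normSq_apply]
  simp only [hopf, hopfCoord, ← hz', ← hw', ← Complex.normSq_eq_norm_sq, Complex.normSq_apply]
  simp
  linear_combination h1

theorem hopf_rotate (t : ℝ) (z : S3) : hopf (rotate t z) = hopf z := by
  have h : Complex.normSq (Complex.exp (t * Complex.I)) = 1 := by
    rw [Complex.normSq_eq_norm_sq, Complex.norm_exp_ofReal_mul_I, one_pow]
  apply Subtype.ext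
  simp only [hopf, hopfCoord, coe_rotate]
  set e := Complex.exp (t * Complex.I)
  have h1 : ∀ u v : ℂ, starRingEnd ℂ (e * u) * (e * v) = starRingEnd ℂ u * v := by
    intro u v
    rw [map_mul, mul_mul_mul_comm, ← Complex.normSq_eq_conj_mul_self, h]
    simp
  have h2 : ‖e‖ = 1 := Complex.norm_exp_ofReal_mul_I t
  simp only [PiLp.smul_apply, smul_eq_mul, h1, norm_mul, h2, one_mul]

theorem norm_sub_sphere_sq {E : Type*} [NormedAddCommGroup E] [InnerProductSpace ℝ E] {x y : E}
    (hx : ‖x‖ = 1) (hy : ‖y‖ = 1) : ‖x - y‖ ^ 2 = 2 - 2 * inner ℝ x y := by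
  rw [norm_sub_sq_real, hx, hy]
  ring

theorem norm_hopf_sub_div_two (z w : S3) :
    ‖(hopf z : EuclideanSpace ℝ (Fin 3)) - hopf w‖ / 2 =
      √(1 - ‖inner ℂ (w : EuclideanSpace ℂ (Fin 2)) z‖ ^ 2) := by
  rw [eq_comm, Real.sqrt_eq_iff_mul_self_eq, eq_comm]
  · have h := norm_sub_sphere_sq (norm_coe_S2 (hopf z)) (norm_coe_S2 (hopf w))
    rw [inner_hopf] at h
    linarith
  · have := norm_inner_le_norm (𝕜 := ℂ) (w : EuclideanSpace ℂ (Fin 2)) z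
    rw [norm_coe_S3, norm_coe_S3, mul_one] at this
    have h0 := norm_nonneg (inner ℂ (w : EuclideanSpace ℂ (Fin 2)) (z : EuclideanSpace ℂ (Fin 2)))
    nlinarith
  · positivity

theorem logWeight_inner (x y : S2) : logWeight (inner ℝ (x : EuclideanSpace ℝ (Fin 3)) y) =
    Real.log (1 + ‖(x : EuclideanSpace ℝ (Fin 3)) - y‖ / 2) := by
  rw [logWeight]
  congr 2
  rw [Real.sqrt_eq_iff_mul_self_eq _ (by positivity)]
  · have h := norm_sub_sphere_sq (norm_coe_S2 x) (norm_coe_S2 y)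
    linarith
  · have := real_inner_le_norm (x : EuclideanSpace ℝ (Fin 3)) y
    rw [norm_coe_S2, norm_coe_S2, mul_one] at this
    linarith

/-- The pull-back of `w` to the unit disc along the fibre of `z`. -/
theorem exists_log_norm_rotate_sub (z w : S3) : ∃ b : ℂ, ‖b‖ ≤ 1 ∧ ∀ θ : ℝ,
    Real.log (1 / ‖(rotate θ z : EuclideanSpace ℂ (Fin 2)) - w‖) =
      -(1 / 2) * Real.log (1 + ‖(hopf z : EuclideanSpace ℝ (Fin 3)) - hopf w‖ / 2)
        - Real.log ‖circleMap 0 1 θ - b‖ := by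
  rw [norm_hopf_sub_div_two]
  set a := inner ℂ (w : EuclideanSpace ℂ (Fin 2)) (z : EuclideanSpace ℂ (Fin 2)) with ha
  have ha1 : ‖a‖ ≤ 1 := by
    have := norm_inner_le_norm (𝕜 := ℂ) (w : EuclideanSpace ℂ (Fin 2)) z
    rwa [norm_coe_S3, norm_coe_S3, mul_one] at this
  set q := √(1 - ‖a‖ ^ 2) with hq
  have hq0 : 0 ≤ q := Real.sqrt_nonneg _
  have hqq : q ^ 2 = 1 - ‖a‖ ^ 2 := Real.sq_sqrt (by nlinarith [norm_nonneg a])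
  have hA : 0 < 1 + q := by positivity
  set b : ℂ := starRingEnd ℂ a / ((1 + q : ℝ) : ℂ) with hb
  have hbn : ‖b‖ = ‖a‖ / (1 + q) := by
    rw [hb, norm_div, RCLike.norm_conj, Complex.norm_real, Real.norm_of_nonneg hA.le]
  refine ⟨b, ?_, fun θ => ?_⟩
  · rw [hbn, div_le_one hA]
    linarith
  have hcm : circleMap 0 1 θ = Complex.exp (θ * Complex.I) := by simp [circleMap]
  rw [hcm]
  set e := Complex.exp (θ * Complex.I) with he
  have hen : ‖e‖ = 1 := Complex.norm_exp_ofReal_mul_I θ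
  -- The constant terms match because `|a|² = (1 - q) (1 + q)`, so `(1 + q) (1 + |b|²) = 2`.
  have hkey : ‖(rotate θ z : EuclideanSpace ℂ (Fin 2)) - w‖ ^ 2 = (1 + q) * ‖e - b‖ ^ 2 := by
    rw [← norm_neg, neg_sub, norm_sub_sq (𝕜 := ℂ), norm_coe_S3, norm_coe_S3, coe_rotate, ← he,
      inner_smul_right, ← ha, ← Complex.normSq_eq_norm_sq (e - b), Complex.normSq_sub,
      Complex.normSq_eq_norm_sq, Complex.normSq_eq_norm_sq, hen, hbn, hb, map_div₀,
      Complex.conj_conj, Complex.conj_ofReal, ← mul_div_assoc, Complex.div_ofReal_re]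
    change 1 ^ 2 - 2 * (e * a).re + 1 ^ 2 = _
    field_simp
    linear_combination -hqq
  have hlog : ∀ t : ℝ, 0 ≤ t → Real.log t = 1 / 2 * Real.log (t ^ 2) := fun t ht => by
    rw [Real.log_pow]; push_cast; ring
  rw [one_div, Real.log_inv, hlog _ (norm_nonneg _), hkey]
  by_cases hz : ‖e - b‖ = 0
  -- Coinciding points: `|b| = 1` forces `q = 0`, and both sides are `0` by the convention `log 0 =
  -- 0`.
  · rw [hz]
    have hbe : ‖b‖ = 1 := by
      rw [norm_eq_zero, sub_eq_zero] at hz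
      rw [← hz, hen]
    rw [hbn, div_eq_one_iff_eq hA.ne'] at hbe
    have : q = 0 := by linarith
    simp [this]
  · rw [Real.log_mul hA.ne' (by positivity), Real.log_pow]
    push_cast
    ring

/-! ### Averages over a phase -/

/-- The uniform distribution on `[0, 2 π]`. -/
def phaseLaw : Measure ℝ := ProbabilityTheory.cond volume (Set.Icc 0 (2 * Real.pi))

theorem volume_Icc_two_pi : (volume (Set.Icc 0 (2 * Real.pi)) : ℝ≥0∞) =
    ENNReal.ofReal (2 * Real.pi) := by
  rw [Real.volume_Icc, sub_zero]

instance isProbabilityMeasure_phaseLaw : IsProbabilityMeasure phaseLaw := by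
  refine ProbabilityTheory.cond_isProbabilityMeasure_of_finite ?_ ?_
  · rw [volume_Icc_two_pi]
    simp [Real.pi_pos]
  · rw [volume_Icc_two_pi]
    exact ENNReal.ofReal_ne_top

theorem phaseLaw_eq : phaseLaw = (ENNReal.ofReal (2 * Real.pi))⁻¹ •
    volume.restrict (Set.Icc 0 (2 * Real.pi)) := by
  rw [phaseLaw, ProbabilityTheory.cond, volume_Icc_two_pi]

theorem integral_phaseLaw (f : ℂ → ℝ) :
    ∫ θ, f (circleMap 0 1 θ) ∂phaseLaw = Real.circleAverage f 0 1 := by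
  have hπ := Real.pi_pos
  rw [phaseLaw_eq, integral_smul_measure, Real.circleAverage_def,
    intervalIntegral.integral_of_le (by positivity), integral_Icc_eq_integral_Ioc,
    ENNReal.toReal_inv, ENNReal.toReal_ofReal (by positivity)]

theorem integrable_phaseLaw {f : ℂ → ℝ} (hf : CircleIntegrable f 0 1) :
    Integrable (fun θ => f (circleMap 0 1 θ)) phaseLaw := by
  have hπ := Real.pi_pos
  rw [phaseLaw_eq]
  refine Integrable.smul_measure ?_ (by simp [hπ])
  have := (intervalIntegrable_iff_integrableOn_Icc_of_le (by positivity)).1 hf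
  exact this

theorem integrable_log_norm_rotate_sub (z w : S3) : Integrable
    (fun θ => Real.log (1 / ‖(rotate θ z : EuclideanSpace ℂ (Fin 2)) - w‖)) phaseLaw := by
  obtain ⟨b, _, hb⟩ := exists_log_norm_rotate_sub z w
  simp_rw [hb]
  exact (integrable_const _).sub (integrable_phaseLaw (circleIntegrable_log_norm_sub_const 1))

theorem integral_log_norm_rotate_sub (z w : S3) :
    ∫ θ, Real.log (1 / ‖(rotate θ z : EuclideanSpace ℂ (Fin 2)) - w‖) ∂phaseLaw =
      -(1 / 2) * Real.log (1 + ‖(hopf z : EuclideanSpace ℝ (Fin 3)) - hopf w‖ / 2) := by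
  obtain ⟨b, hb1, hb⟩ := exists_log_norm_rotate_sub z w
  simp_rw [hb]
  rw [integral_sub (integrable_const _)
    (integrable_phaseLaw (circleIntegrable_log_norm_sub_const 1))]
  have h := integral_phaseLaw (fun u => Real.log ‖u - b‖)
  have h2 := circleAverage_log_norm_sub_const_of_mem_closedBall (a := b) (c := 0) (R := 1)
    (by simpa using hb1)
  rw [h, h2]
  simp

/-- The integrand `u` is at least `-log 2`, so `|u| ≤ u + 2 log 2`, and the mean of `u` is
nonpositive. The bound is uniform in `z`, `w`, as Fubini's theorem requires. -/
theorem integral_abs_log_norm_rotate_sub_le (z w : S3) :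
    ∫ θ, |Real.log (1 / ‖(rotate θ z : EuclideanSpace ℂ (Fin 2)) - w‖)| ∂phaseLaw ≤
      2 * Real.log 2 := by
  have hlow : ∀ θ : ℝ, -Real.log 2 ≤
      Real.log (1 / ‖(rotate θ z : EuclideanSpace ℂ (Fin 2)) - w‖) := fun θ => by
    rw [one_div, Real.log_inv, neg_le_neg_iff]
    have h2 : ‖(rotate θ z : EuclideanSpace ℂ (Fin 2)) - w‖ ≤ 2 := by
      refine (norm_sub_le _ _).trans ?_
      rw [norm_coe_S3, norm_coe_S3]
      norm_num
    rcases (norm_nonneg ((rotate θ z : EuclideanSpace ℂ (Fin 2)) - w)).eq_or_lt with h | h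
    · rw [← h, Real.log_zero]
      exact Real.log_nonneg (by norm_num)
    · exact Real.log_le_log h h2
  have hl2 : 0 ≤ Real.log 2 := Real.log_nonneg (by norm_num)
  have h1 : ∫ θ, |Real.log (1 / ‖(rotate θ z : EuclideanSpace ℂ (Fin 2)) - w‖)| ∂phaseLaw ≤
      ∫ θ, (Real.log (1 / ‖(rotate θ z : EuclideanSpace ℂ (Fin 2)) - w‖) + 2 * Real.log 2)
        ∂phaseLaw := by
    refine integral_mono (integrable_log_norm_rotate_sub z w).abs
      ((integrable_log_norm_rotate_sub z w).add (integrable_const _)) fun θ => ?_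
    have := hlow θ
    exact abs_le.2 ⟨by linarith, by linarith⟩
  rw [integral_add (integrable_log_norm_rotate_sub z w) (integrable_const _),
    integral_log_norm_rotate_sub] at h1
  have h3 : 0 ≤ Real.log (1 + ‖(hopf z : EuclideanSpace ℝ (Fin 3)) - hopf w‖ / 2) :=
    Real.log_nonneg (by have := norm_nonneg ((hopf z : EuclideanSpace ℝ (Fin 3)) - hopf w)
                        linarith)
  simp only [integral_const, probReal_univ, one_smul] at h1
  linarith

/-! ### Roots of unity on a fibre -/

theorem sum_log_norm_roots (k : ℕ) (θ : ℝ) (z : S3) :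
    ∑ a : Fin k, ∑ b : Fin k, (if a ≠ b then
      Real.log (1 / ‖(rotate (θ + 2 * Real.pi * (a : ℕ) / k) z : EuclideanSpace ℂ (Fin 2)) -
        rotate (θ + 2 * Real.pi * (b : ℕ) / k) z‖) else 0) = -(k * Real.log k) := by
  cases k with
  | zero => simp
  | succ n =>
    set ζ : ℂ := Complex.exp (2 * Real.pi * Complex.I / ((n + 1 : ℕ) : ℂ)) with hζ
    have hprim : IsPrimitiveRoot ζ (n + 1) := Complex.isPrimitiveRoot_exp (n + 1) n.succ_ne_zero
    have hζn : ‖ζ‖ = 1 := hprim.norm'_eq_one n.succ_ne_zero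
    have hmod : ∀ m : ℕ, ζ ^ (m % (n + 1)) = ζ ^ m := fun m => by
      conv_rhs => rw [← Nat.div_add_mod m (n + 1), pow_add, pow_mul, hprim.pow_eq_one, one_pow,
        one_mul]
    have hrot : ∀ a : Fin (n + 1),
        (rotate (θ + 2 * Real.pi * (a : ℕ) / (n + 1 : ℕ)) z : EuclideanSpace ℂ (Fin 2)) =
          ζ ^ (a : ℕ) • (rotate θ z : EuclideanSpace ℂ (Fin 2)) := fun a => by
      rw [coe_rotate, coe_rotate, smul_smul, hζ, ← Complex.exp_nat_mul, ← Complex.exp_add]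
      congr 2
      push_cast
      ring
    have hdist : ∀ a c : Fin (n + 1),
        ‖(rotate (θ + 2 * Real.pi * (a : ℕ) / (n + 1 : ℕ)) z : EuclideanSpace ℂ (Fin 2)) -
          rotate (θ + 2 * Real.pi * ((a + c : Fin (n + 1)) : ℕ) / (n + 1 : ℕ)) z‖ =
        ‖1 - ζ ^ (c : ℕ)‖ := fun a c => by
      rw [hrot, hrot, ← sub_smul, norm_smul, norm_coe_S3, mul_one, Fin.val_add, hmod, pow_add]
      rw [show ζ ^ (a : ℕ) - ζ ^ (a : ℕ) * ζ ^ (c : ℕ) = ζ ^ (a : ℕ) * (1 - ζ ^ (c : ℕ)) by ring,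
        norm_mul, norm_pow, hζn, one_pow, one_mul]
    have hinner : ∀ a : Fin (n + 1), ∑ b : Fin (n + 1), (if a ≠ b then
        Real.log (1 / ‖(rotate (θ + 2 * Real.pi * (a : ℕ) / (n + 1 : ℕ)) z :
          EuclideanSpace ℂ (Fin 2)) - rotate (θ + 2 * Real.pi * (b : ℕ) / (n + 1 : ℕ)) z‖)
        else 0) = -Real.log ((n + 1 : ℕ) : ℝ) := fun a => by
      rw [← Equiv.sum_comp (Equiv.addLeft a)]
      simp only [Equiv.coe_addLeft, hdist]
      rw [Fin.sum_univ_succ]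
      have h0 : ∀ c : Fin n, a ≠ a + c.succ := fun c h => by
        have : c.succ = 0 := by simpa using h.symm
        exact Fin.succ_ne_zero c this
      simp only [h0, ne_eq, not_false_eq_true, if_true, add_zero, not_true_eq_false, if_false,
        zero_add, Fin.val_succ, one_div, Real.log_inv, Finset.sum_neg_distrib]
      rw [Fin.sum_univ_eq_sum_range (fun c => Real.log ‖1 - ζ ^ (c + 1)‖) n, ← Real.log_prod,
        ← norm_prod, hprim.prod_one_sub_pow_eq_order]
      · norm_cast
      · intro c hc
        rw [norm_ne_zero_iff, sub_ne_zero]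
        intro h
        have := hprim.pow_ne_one_of_pos_of_lt (Nat.succ_ne_zero c)
          (Nat.succ_lt_succ (Finset.mem_range.1 hc))
        exact this h.symm
    rw [Finset.sum_congr rfl fun a _ => hinner a]
    simp

/-! ### The expected logarithmic energy -/

theorem map_points_phases {Ω : Type*} [MeasurableSpace Ω] {P : Measure Ω} [IsProbabilityMeasure P]
    {r : ℕ} {X : Ω → Fin r → S2} {Θ : Ω → Fin r → ℝ} (hX : Measurable X)
    (hΘ : IsIndependentUniformPhases P X Θ) {i j : Fin r} (hij : i ≠ j) :
    P.map (fun ω => ((X ω, Θ ω j), Θ ω i)) = ((P.map X).prod phaseLaw).prod phaseLaw := by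
  have hΘm := hΘ.measurable
  have hm : ∀ l, Measurable fun ω => Θ ω l := fun l => by fun_prop
  -- `pdf.IsUniform` unfolds to the statement that the law is the conditioned Lebesgue measure.
  have hlaw : ∀ l, P.map (fun ω => Θ ω l) = phaseLaw := fun l => hΘ.uniform l
  have h1 : P.map (fun ω => (Θ ω j, Θ ω i)) = phaseLaw.prod phaseLaw := by
    have := (indepFun_iff_map_prod_eq_prod_map_map (hm j).aemeasurable (hm i).aemeasurable).1
      (hΘ.iIndep.indepFun hij.symm)
    rw [this, hlaw, hlaw]
  have h2 : IndepFun X (fun ω => (Θ ω j, Θ ω i)) P :=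
    hΘ.indep.comp (φ := id) (ψ := fun t : Fin r → ℝ => (t j, t i)) measurable_id (by fun_prop)
  have h3 := (indepFun_iff_map_prod_eq_prod_map_map hX.aemeasurable
    ((hm j).prodMk (hm i)).aemeasurable).1 h2
  rw [h1] at h3
  have : IsProbabilityMeasure (P.map X) := Measure.isProbabilityMeasure_map hX.aemeasurable
  have h4 := (measurePreserving_prodAssoc (P.map X) phaseLaw phaseLaw).symm.map_eq
  rw [← h4, ← h3, Measure.map_map (MeasurableEquiv.measurable _)
    (hX.prodMk ((hm j).prodMk (hm i)))]
  rfl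

/-- Fubini, integrating first over `Θ i` with everything else fixed. The offsets `α`, `β` are
absorbed into the base points and do not change the Hopf images, so all `k²` pairs over two fibres
have the same expectation. -/
theorem integrable_and_integral_pair {Ω : Type*} [MeasurableSpace Ω] {P : Measure Ω}
    [IsProbabilityMeasure P] {r : ℕ} {X : Ω → Fin r → S2} {Θ : Ω → Fin r → ℝ} {s : S2 → S3}
    (hX : Measurable X) (hΘ : IsIndependentUniformPhases P X Θ) (hs : Measurable s)
    (hhs : ∀ x, hopf (s x) = x) {i j : Fin r} (hij : i ≠ j) (α β : ℝ) :
    Integrable (fun ω => Real.log (1 / ‖(rotate (Θ ω i + α) (s (X ω i)) :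
      EuclideanSpace ℂ (Fin 2)) - rotate (Θ ω j + β) (s (X ω j))‖)) P ∧
    ∫ ω, Real.log (1 / ‖(rotate (Θ ω i + α) (s (X ω i)) :
      EuclideanSpace ℂ (Fin 2)) - rotate (Θ ω j + β) (s (X ω j))‖) ∂P =
      -(1 / 2) * ∫ ω, logWeight (inner ℝ (X ω i : EuclideanSpace ℝ (Fin 3)) (X ω j)) ∂P := by
  let F : ((Fin r → S2) × ℝ) × ℝ → ℝ := fun q =>
    Real.log (1 / ‖(rotate (q.2 + α) (s (q.1.1 i)) : EuclideanSpace ℂ (Fin 2)) -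
      rotate (q.1.2 + β) (s (q.1.1 j))‖)
  have hΘm := hΘ.measurable
  have hG : Measurable fun ω => ((X ω, Θ ω j), Θ ω i) := by fun_prop
  have hF : Measurable F := by
    simp only [F, coe_rotate]
    have h1 : ∀ l, Measurable fun q : ((Fin r → S2) × ℝ) × ℝ =>
        (s (q.1.1 l) : EuclideanSpace ℂ (Fin 2)) := fun l =>
      measurable_subtype_coe.comp (hs.comp (by fun_prop))
    have h2 := h1 i
    have h3 := h1 j
    refine Real.measurable_log.comp (Measurable.const_div (Measurable.norm (Measurable.sub ?_ ?_)) 1)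
    · exact Measurable.smul (f := fun q : ((Fin r → S2) × ℝ) × ℝ =>
        Complex.exp ((q.2 + α : ℝ) * Complex.I)) (by fun_prop) h2
    · exact Measurable.smul (f := fun q : ((Fin r → S2) × ℝ) × ℝ =>
        Complex.exp ((q.1.2 + β : ℝ) * Complex.I)) (by fun_prop) h3
  have : IsProbabilityMeasure (P.map X) := Measure.isProbabilityMeasure_map hX.aemeasurable
  have hlaw := map_points_phases hX hΘ hij
  have hFr : ∀ p θ, F (p, θ) = Real.log (1 / ‖(rotate θ (rotate α (s (p.1 i))) :
      EuclideanSpace ℂ (Fin 2)) - rotate (p.2 + β) (s (p.1 j))‖) := fun p θ => by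
    simp only [F, rotate_add θ α]
  have hint : Integrable F (((P.map X).prod phaseLaw).prod phaseLaw) := by
    rw [integrable_prod_iff hF.aestronglyMeasurable]
    constructor
    · refine Filter.Eventually.of_forall fun p => ?_
      simp_rw [hFr]
      exact integrable_log_norm_rotate_sub _ _
    · refine Integrable.of_bound (C := 2 * Real.log 2)
        hF.norm.stronglyMeasurable.integral_prod_right'.aestronglyMeasurable
        (Filter.Eventually.of_forall fun p => ?_)
      rw [Real.norm_of_nonneg (integral_nonneg fun _ => norm_nonneg _)]
      simp_rw [hFr]
      exact integral_abs_log_norm_rotate_sub_le _ _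
  have hint' := hint
  rw [← hlaw, integrable_map_measure hF.aestronglyMeasurable hG.aemeasurable] at hint'
  refine ⟨hint', ?_⟩
  have h1 : ∫ ω, F ((X ω, Θ ω j), Θ ω i) ∂P = ∫ q, F q ∂(((P.map X).prod phaseLaw).prod phaseLaw) := by
    rw [← hlaw, integral_map hG.aemeasurable hF.aestronglyMeasurable]
  change ∫ ω, F ((X ω, Θ ω j), Θ ω i) ∂P = _
  have hw : Measurable fun x : Fin r → S2 =>
      -(1 / 2) * logWeight (inner ℝ (x i : EuclideanSpace ℝ (Fin 3)) (x j)) := by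
    have h0 : ∀ l, Measurable fun x : Fin r → S2 => (x l : EuclideanSpace ℝ (Fin 3)) := fun l =>
      measurable_subtype_coe.comp (measurable_pi_apply l)
    exact (continuous_logWeight.measurable.comp ((h0 i).inner (h0 j))).const_mul _
  rw [h1, integral_prod _ hint]
  simp_rw [hFr, integral_log_norm_rotate_sub, hopf_rotate, hhs, ← logWeight_inner]
  rw [integral_fun_fst (f := fun x : Fin r → S2 =>
    -(1 / 2) * logWeight (inner ℝ (x i : EuclideanSpace ℝ (Fin 3)) (x j))), probReal_univ, one_smul,
    integral_map hX.aemeasurable hw.aestronglyMeasurable, integral_const_mul]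

theorem logEnergy_hopfLift {r : ℕ} (s : S2 → S3) (k : ℕ) (x : Fin r → S2) (θ : Fin r → ℝ) :
    logEnergy (hopfLift s k x θ) = ∑ p : Fin r × Fin r, (if p.1 ≠ p.2 then
      ∑ a : Fin k, ∑ b : Fin k,
        Real.log (1 / ‖(rotate (θ p.1 + 2 * Real.pi * (a : ℕ) / k) (s (x p.1)) :
          EuclideanSpace ℂ (Fin 2)) - rotate (θ p.2 + 2 * Real.pi * (b : ℕ) / k) (s (x p.2))‖)
      else 0) - r * (k * Real.log k) := by
  have hd : (r : ℝ) * (k * Real.log k) =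
      ∑ i : Fin r, ∑ j : Fin r, if i = j then k * Real.log k else 0 := by simp
  rw [logEnergy, Fintype.sum_prod_type, Fintype.sum_prod_type, hd, ← Finset.sum_sub_distrib]
  refine Finset.sum_congr rfl fun i _ => ?_
  simp_rw [Fintype.sum_prod_type]
  rw [Finset.sum_comm, ← Finset.sum_sub_distrib]
  refine Finset.sum_congr rfl fun j _ => ?_
  by_cases hij : i = j
  · subst hij
    simp only [ne_eq, not_true_eq_false, if_false, if_true, zero_sub]
    rw [← sum_log_norm_roots k (θ i) (s (x i))]
    refine Finset.sum_congr rfl fun a _ => Finset.sum_congr rfl fun b _ => ?_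
    simp [hopfLift]
  · simp [hopfLift, hij]

/-- Hat-box in one variable and total area in the other: the factor is `4 π · 2 π / (4 π)² = 1/2`.
-/
theorem integral_kernel_mul_logWeight (L : ℕ) :
    ∫ z : S2 × S2, (((L : ℝ) + 1) ^ 2 / (4 * Real.pi) * (((L : ℝ) + 1) ^ 2 / (4 * Real.pi))
        - harmonicKernel L z.1 z.2 * harmonicKernel L z.2 z.1) *
        logWeight (inner ℝ (z.1 : EuclideanSpace ℝ (Fin 3)) z.2)
        ∂(surfaceMeasure.prod surfaceMeasure) =
      ((((L : ℝ) + 1) ^ 2) ^ 2 - kernelIntegral L) / 2 := by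
  have hS : CompactSpace S2 := Metric.sphere.compactSpace _ _
  have hπ := Real.pi_pos
  set g : ℝ → ℝ := fun t => ((((L : ℝ) + 1) ^ 2) ^ 2 - (kernelPoly L).eval t ^ 2) /
    (4 * Real.pi) ^ 2 * logWeight t with hg
  have hgc : Continuous g := by
    have := continuous_logWeight
    fun_prop
  have he : ∀ z : S2 × S2, (((L : ℝ) + 1) ^ 2 / (4 * Real.pi) * (((L : ℝ) + 1) ^ 2 / (4 * Real.pi))
        - harmonicKernel L z.1 z.2 * harmonicKernel L z.2 z.1) *
        logWeight (inner ℝ (z.1 : EuclideanSpace ℝ (Fin 3)) z.2) =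
      g (inner ℝ (z.2 : EuclideanSpace ℝ (Fin 3)) z.1) := fun z => by
    rw [harmonicKernel_comm L z.1 z.2, harmonicKernel, real_inner_comm]
    simp only [hg]
    ring
  simp_rw [he]
  rw [integral_prod _ (Continuous.integrable_of_hasCompactSupport (by fun_prop)
    (HasCompactSupport.of_compactSpace _))]
  simp_rw [integral_comp_inner hgc]
  have harea : surfaceMeasure.real Set.univ = 4 * Real.pi := by
    have := sphereIntegral_one
    simp only [sphereIntegral, realEval, map_one, integral_const, Complex.real_smul, mul_one] at this
    exact_mod_cast this
  rw [integral_const, harea, smul_eq_mul]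
  have hw : ∫ t in (-1 : ℝ)..1, logWeight t = 1 := by
    have h := kernelIntegral_zero_eq
    simpa only [kernelIntegral, kernelPoly_zero, one_pow, one_mul] using h
  have hgi : ∫ t in (-1 : ℝ)..1, g t =
      ((((L : ℝ) + 1) ^ 2) ^ 2 - kernelIntegral L) / (4 * Real.pi) ^ 2 := by
    have h1 : ∀ t, g t = (1 / (4 * Real.pi) ^ 2) * ((((L : ℝ) + 1) ^ 2) ^ 2 * logWeight t -
        (kernelPoly L).eval t ^ 2 * logWeight t) := fun t => by simp only [hg]; ring
    simp_rw [h1]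
    have hwc := continuous_logWeight
    rw [intervalIntegral.integral_const_mul, intervalIntegral.integral_sub
      (Continuous.intervalIntegrable (by fun_prop) _ _)
      (Continuous.intervalIntegrable (by fun_prop) _ _), intervalIntegral.integral_const_mul, hw,
      kernelIntegral]
    ring
  rw [hgi]
  field_simp
  norm_num

theorem abs_logWeight_inner_le (x y : S2) :
    |logWeight (inner ℝ (x : EuclideanSpace ℝ (Fin 3)) y)| ≤ 1 := by
  rw [logWeight_inner]
  have h0 := norm_nonneg ((x : EuclideanSpace ℝ (Fin 3)) - y)
  have h2 : ‖(x : EuclideanSpace ℝ (Fin 3)) - y‖ ≤ 2 := by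
    refine (norm_sub_le _ _).trans ?_
    rw [norm_coe_S2, norm_coe_S2]
    norm_num
  rw [abs_of_nonneg (Real.log_nonneg (by linarith))]
  refine (Real.log_le_sub_one_of_pos (by linarith)).trans (by linarith)

theorem sum_integral_logWeight {Ω : Type*} [MeasurableSpace Ω] {P : Measure Ω}
    [IsProbabilityMeasure P] {L : ℕ} {X : Ω → Fin ((L + 1) ^ 2) → S2}
    (hX : IsHarmonicEnsemble L P X) :
    ∑ p : Fin ((L + 1) ^ 2) × Fin ((L + 1) ^ 2), (if p.1 ≠ p.2 then
      ∫ ω, logWeight (inner ℝ (X ω p.1 : EuclideanSpace ℝ (Fin 3)) (X ω p.2)) ∂P else 0) =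
      ((((L : ℝ) + 1) ^ 2) ^ 2 - kernelIntegral L) / 2 := by
  obtain ⟨K, hK, hdet⟩ := hX
  rcases Nat.eq_zero_or_pos L with rfl | hL
  -- For `L = 0` there is a single point and no two-point intensity; both sides are `0` because `I_0
  -- = 1`.
  · rw [kernelIntegral_zero_eq, Finset.sum_eq_zero]
    · simp
    · intro p _
      have : Subsingleton (Fin ((0 + 1) ^ 2)) := by
        simpa using (inferInstance : Subsingleton (Fin 1))
      rw [if_neg]
      simpa using Subsingleton.elim p.1 p.2
  obtain ⟨ρ, hρK, hρ⟩ := hdet.intensity 2 (by norm_num) (by nlinarith)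
  have hρe : ∀ z : S2 × S2, ρ ![z.1, z.2] =
      ((L : ℝ) + 1) ^ 2 / (4 * Real.pi) * (((L : ℝ) + 1) ^ 2 / (4 * Real.pi))
        - harmonicKernel L z.1 z.2 * harmonicKernel L z.2 z.1 := fun z => by
    apply Complex.ofReal_injective
    rw [hρK, Matrix.det_fin_two]
    simp only [Matrix.of_apply, Matrix.cons_val_zero, Matrix.cons_val_one,
      hK.eq_harmonicKernel]
    rw [harmonicKernel_self, harmonicKernel_self]
    push_cast
    ring
  have hρm : Measurable fun z : S2 × S2 => ρ ![z.1, z.2] := by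
    simp_rw [hρe, harmonicKernel]
    exact Continuous.measurable (by fun_prop)
  have hf : Measurable fun z : S2 × S2 =>
      logWeight (inner ℝ (z.1 : EuclideanSpace ℝ (Fin 3)) z.2) := by
    have := continuous_logWeight
    exact Continuous.measurable (by fun_prop)
  rw [integral_sum_pairs hdet.simple hρ hρm hf fun z => abs_logWeight_inner_le z.1 z.2]
  simp_rw [hρe]
  exact integral_kernel_mul_logWeight L

theorem integrable_and_integral_logEnergy {Ω : Type*} [MeasurableSpace Ω] {P : Measure Ω}
    [IsProbabilityMeasure P] {L : ℕ} (k : ℕ) {X : Ω → Fin ((L + 1) ^ 2) → S2}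
    {Θ : Ω → Fin ((L + 1) ^ 2) → ℝ} {s : S2 → S3} (hX : IsHarmonicEnsemble L P X)
    (hΘ : IsIndependentUniformPhases P X Θ) (hs : Measurable s) (hhs : ∀ x, hopf (s x) = x) :
    Integrable (fun ω => logEnergy (hopfLift s k (X ω) (Θ ω))) P ∧
    ∫ ω, logEnergy (hopfLift s k (X ω) (Θ ω)) ∂P =
      -((k : ℝ) ^ 2 / 4) * ((((L : ℝ) + 1) ^ 2) ^ 2 - kernelIntegral L)
        - ((L : ℝ) + 1) ^ 2 * (k * Real.log k) := by
  have hXm : Measurable X := by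
    obtain ⟨K, _, hdet⟩ := hX
    exact hdet.simple.measurable
  simp_rw [logEnergy_hopfLift]
  have hpair : ∀ p : Fin ((L + 1) ^ 2) × Fin ((L + 1) ^ 2), Integrable (fun ω =>
      (if p.1 ≠ p.2 then ∑ a : Fin k, ∑ b : Fin k,
        Real.log (1 / ‖(rotate (Θ ω p.1 + 2 * Real.pi * (a : ℕ) / k) (s (X ω p.1)) :
          EuclideanSpace ℂ (Fin 2)) -
          rotate (Θ ω p.2 + 2 * Real.pi * (b : ℕ) / k) (s (X ω p.2))‖) else 0)) P ∧
      ∫ ω, (if p.1 ≠ p.2 then ∑ a : Fin k, ∑ b : Fin k,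
        Real.log (1 / ‖(rotate (Θ ω p.1 + 2 * Real.pi * (a : ℕ) / k) (s (X ω p.1)) :
          EuclideanSpace ℂ (Fin 2)) -
          rotate (Θ ω p.2 + 2 * Real.pi * (b : ℕ) / k) (s (X ω p.2))‖) else 0) ∂P =
      -((k : ℝ) ^ 2 / 2) * (if p.1 ≠ p.2 then
        ∫ ω, logWeight (inner ℝ (X ω p.1 : EuclideanSpace ℝ (Fin 3)) (X ω p.2)) ∂P else 0) := by
    intro p
    by_cases hp : p.1 ≠ p.2
    · simp only [if_pos hp]
      have h := fun a b : Fin k => integrable_and_integral_pair hXm hΘ hs hhs hp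
        (2 * Real.pi * (a : ℕ) / k) (2 * Real.pi * (b : ℕ) / k)
      have h1 := fun a : Fin k => integrable_finsetSum Finset.univ fun b _ => (h a b).1
      refine ⟨integrable_finsetSum _ fun a _ => h1 a, ?_⟩
      rw [integral_finsetSum _ fun a _ => h1 a]
      simp_rw [integral_finsetSum _ fun b _ => (h _ b).1, (h _ _).2]
      simp
      ring
    · simp only [if_neg hp]
      simp
  have hsum := integrable_finsetSum Finset.univ fun p _ => (hpair p).1
  refine ⟨hsum.sub (integrable_const _), ?_⟩
  rw [integral_sub hsum (integrable_const _), integral_finsetSum _ fun p _ => (hpair p).1,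
    Finset.sum_congr rfl fun p _ => (hpair p).2, ← Finset.mul_sum, sum_integral_logWeight hX]
  simp only [integral_const, probReal_univ, one_smul]
  push_cast
  ring

end HopfHarmonic

end

/-! ### The asymptotic expansion -/

theorem proposition3p7 :
    ∃ C : ℝ, ∀ (L k : ℕ), 1 ≤ k →
      ∀ (Ω : Type*) [MeasurableSpace Ω] (P : Measure Ω) [IsProbabilityMeasure P]
        (X : Ω → Fin ((L + 1) ^ 2) → HopfHarmonic.S2) (Θ : Ω → Fin ((L + 1) ^ 2) → ℝ)
        (s : HopfHarmonic.S2 → HopfHarmonic.S3),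
        HopfHarmonic.IsHarmonicEnsemble L P X →
        HopfHarmonic.IsIndependentUniformPhases P X Θ →
        Measurable s → (∀ x, HopfHarmonic.hopf (s x) = x) →
        ∀ (r N : ℝ), r = ((L : ℝ) + 1) ^ 2 → N = (k : ℝ) * r →
          Integrable
            (fun ω => HopfHarmonic.logEnergy (HopfHarmonic.hopfLift s k (X ω) (Θ ω))) P ∧
          |(∫ ω, HopfHarmonic.logEnergy (HopfHarmonic.hopfLift s k (X ω) (Θ ω)) ∂P)
              - (-(N ^ 2 / 4) - N * Real.log k
                  + (k : ℝ) ^ 2 * Real.sqrt r * Real.log r / (4 * Real.pi))|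
            ≤ C * ((k : ℝ) ^ 2 * Real.sqrt r) := by
  -- The constant is `8 / 4`: the error `8 (L + 1)` of the kernel integral, multiplied by `k² / 4`.
  refine ⟨2, fun L k _ Ω _ P _ X Θ s hX hΘ hs hhs r N hr hN => ?_⟩
  obtain ⟨h1, h2⟩ := HopfHarmonic.integrable_and_integral_logEnergy k hX hΘ hs hhs
  refine ⟨h1, ?_⟩
  have hL : (0 : ℝ) ≤ (L : ℝ) + 1 := by positivity
  have hb := HopfHarmonic.abs_kernelIntegral_sub_log_le L
  have hsqrt : Real.sqrt r = (L : ℝ) + 1 := by rw [hr, Real.sqrt_sq hL]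
  have hlog : Real.log r = 2 * Real.log ((L : ℝ) + 1) := by rw [hr, Real.log_pow]; norm_num
  have key : -((k : ℝ) ^ 2 / 4) * ((((L : ℝ) + 1) ^ 2) ^ 2 - HopfHarmonic.kernelIntegral L)
        - ((L : ℝ) + 1) ^ 2 * (k * Real.log k) - (-(N ^ 2 / 4) - N * Real.log k
                  + (k : ℝ) ^ 2 * Real.sqrt r * Real.log r / (4 * Real.pi)) =
      (k : ℝ) ^ 2 / 4 * (HopfHarmonic.kernelIntegral L -
        2 / Real.pi * ((L + 1) * Real.log (L + 1))) := by
    rw [hsqrt, hlog, hN, hr]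
    field_simp
    ring
  rw [h2, key, abs_mul, abs_of_nonneg (by positivity), hsqrt]
  calc (k : ℝ) ^ 2 / 4 * |HopfHarmonic.kernelIntegral L -
        2 / Real.pi * ((L + 1) * Real.log (L + 1))|
      ≤ (k : ℝ) ^ 2 / 4 * (8 * ((L : ℝ) + 1)) := by gcongr
    _ = 2 * ((k : ℝ) ^ 2 * ((L : ℝ) + 1)) := by ring
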